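/- \textbf{Lemma (Lower bound on field energy), with its application to the magnetic field.} Setting. Let $\mathcal F$ be the bosonic Fock space of photons with modes $(k,\lambda)\in\mathbb R^3\times\{1,2\}$, with annihilation and creation operators $a_\lambda(k),a^*_\lambda(k)$, $[a_\lambda(k),a^*_{\lambda'}(k')]=\delta_{\lambda\lambda'}\delta(k-k')$, and let $H_f=\sum_{\lambda=1}^2\int_{\mathbb R^3}|k|\,a^*_\lambda(k)a_\lambda(k)\,dk$ be the field energy. Let $0<\Lambda<\infty$ and let $J$ be a set of integers. For $\lambda=1,2$ and $j\in J$ let $v_{\lambda,j}$ be a tempered distribution on $\mathbb R^3$ (for instance a function) whose Fourier transform, with the convention $\widehat g(k)=(2\pi)^{-3/2}\int g(x)e^{-ik\cdot x}\,dx$, is a function $\widehat v_{\lambda,j}$ with $\int_{|k|<\Lambda}|k|\,|\widehat v_{\lambda,j}(k)|^2dk<\infty$. Put $$L_j(y)=\sum_{\lambda=1}^2\int_{|k|<\Lambda}\sqrt{|k|}\;\widehat v_{\lambda,j}(k)\,e^{ik\cdot y}a_\lambda(k)\,dk .$$ For a real function $w\in L^1(\mathbb R^3)$ let $$\|w\|_v=\sup_{f}\frac{\sum_j\int_{\mathbb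 R^3}\big|\sum_\lambda (f_\lambda * v_{\lambda,j})(x)\big|^2|w(x)|\,dx}{\sum_\lambda\int_{\mathbb R^3}|f_\lambda(x)|^2dx},$$ the supremum being over nonzero pairs $f=(f_1,f_2)$ of Schwartz functions. All operator inequalities below are inequalities of quadratic forms; in particular $L^*L$ has the form $\|L\Psi\|^2$ and $\pm(L\pm L^*)^2$ has the form $\|(L\pm L^*)\Psi\|^2$. (a) If $\|w\|_v\le1$, then on all $\Psi\in\mathcal F$ of finite field energy $$H_f\ \ge\ \sum_j\int_{\mathbb R^3}w(y)\,L_j^*(y)L_j(y)\,dy ,$$ where the integrals and the sum over $j$ converge absolutely. (b) If $\|w\|_v\le 1$ and moreover $w(y)\ge0$ for all $y$, then, for any choice of the sign $+$ or $-$ for each $j$, $$H_f\ \ge\ \frac14\sum_j\pm\int_{\mathbb R^3}w(y)\,\big(L_j(y)\pm L_j^*(y)\big)^2dy-\frac12\sum_j\sum_{\lambda=1}^2\int_{|k|<\Lambda}|k|\,|\widehat v_{\lambda,j}(k)|^2dk\int_{\mathbb R^3}w(y)\,dy .$$ (c) Let $\varepsilon_1(k),\varepsilon_2(k)\in\mathbb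 R^3$ be measurable in $k$ and, for $k\ne0$, orthonormal and perpendicular to $k$, and let $$B^\Lambda(x)=\frac{i}{2\pi}\sum_{\lambda=1}^2\int_{|k|\le\Lambda}\frac{k\wedge\varepsilon_\lambda(k)}{\sqrt{|k|}}\Big(a_\lambda(k)e^{ik\cdot x}-a^*_\lambda(k)e^{-ik\cdot x}\Big)dk .$$ If $w\in L^1(\mathbb R^3)$ and $0\le w(y)\le1$ for all $y$, then $$H_f\ \ge\ \frac1{8\pi}\int_{\mathbb R^3}B^\Lambda(x)^2\,w(x)\,dx-\frac{\Lambda^4}{8\pi^2}\int_{\mathbb R^3}w(y)\,dy .$$ -/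

import Mathlib

open MeasureTheory SchwartzMap FourierTransform
open scoped ENNReal ComplexConjugate SchwartzMap

noncomputable section

namespace FieldEnergy

/-- Position space and momentum space `ℝ³`. -/
abbrev R3 : Type := EuclideanSpace ℝ (Fin 3)

/-! ### Fourier transform and convolution for tempered distributions

The convention is `ĝ(k) = (2π)^(-3/2) ∫ g(x) exp(-i k·x) dx`. -/

/-- Dilation `x ↦ x / (2π)` of `ℝ³`. -/
def dilation : R3 ≃L[ℝ] R3 :=
  ContinuousLinearEquiv.smulLeft (Units.mk0 ((2 * Real.pi)⁻¹ : ℝ) (by positivity))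

/-- The Fourier transform of a Schwartz function; see `schwartzFourier_apply`. -/
def schwartzFourier (φ : 𝓢(R3, ℂ)) : 𝓢(R3, ℂ) :=
  (((2 * Real.pi) ^ (-(3 / 2) : ℝ) : ℝ) : ℂ) •
    compCLMOfContinuousLinearEquiv ℂ dilation (𝓕 φ)

theorem schwartzFourier_apply (φ : 𝓢(R3, ℂ)) (x : R3) :
    schwartzFourier φ x = (((2 * Real.pi) ^ (-(3 / 2) : ℝ) : ℝ) : ℂ) *
      ∫ k : R3, φ k * Complex.exp (-(Complex.I * (inner ℝ k x : ℝ))) := by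
  have hd : dilation x = ((2 * Real.pi)⁻¹ : ℝ) • x := rfl
  have h : schwartzFourier φ x = (((2 * Real.pi) ^ (-(3 / 2) : ℝ) : ℝ) : ℂ) *
      (𝓕 φ) (dilation x) := rfl
  rw [h, SchwartzMap.fourier_coe, Real.fourier_eq']
  congr 1
  refine integral_congr_ae (Filter.Eventually.of_forall fun k => ?_)
  simp only [hd, inner_smul_right, smul_eq_mul]
  rw [mul_comm]
  congr 2
  have : (Real.pi : ℂ) ≠ 0 := by exact_mod_cast Real.pi_ne_zero
  push_cast
  field_simp

/-- The function `vhat` is the Fourier transform of the tempered distribution `v`: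
`⟨vhat, φ⟩ = ⟨v, φ̂⟩` for all Schwartz functions `φ`. -/
def IsFourierTransformOf (vhat : R3 → ℂ) (v : 𝓢'(R3, ℂ)) : Prop :=
  ∀ φ : 𝓢(R3, ℂ), Integrable (fun k => vhat k * φ k) ∧
    v (schwartzFourier φ) = ∫ k, vhat k * φ k

/-- The Schwartz function `y ↦ f (x - y)`. -/
def reflectTranslate (f : 𝓢(R3, ℂ)) (x : R3) : 𝓢(R3, ℂ) :=
  compSubConstCLM ℂ x
    (compCLMOfContinuousLinearEquiv ℂ (ContinuousLinearEquiv.neg ℝ (M := R3)) f)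

theorem reflectTranslate_apply (f : 𝓢(R3, ℂ)) (x y : R3) :
    reflectTranslate f x y = f (x - y) := by
  change f (-(y - x)) = f (x - y)
  rw [neg_sub]

/-- The convolution `(f ∗ v)(x) = ∫ f(x - y) v(y) dy`, the integral being the pairing with the
tempered distribution `v`. -/
def conv (f : 𝓢(R3, ℂ)) (v : 𝓢'(R3, ℂ)) (x : R3) : ℂ :=
  v (reflectTranslate f x)

/-- The norm
`‖w‖_v = sup_f (∑_j ∫ |∑_λ (f_λ ∗ v_{λ,j})(x)|² |w(x)| dx) / (∑_λ ∫ |f_λ(x)|² dx)`.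
(For `f = 0` the quotient is `0 / 0 = 0` and does not affect the supremum.) -/
def weightNorm {J : Set ℤ} (v : Fin 2 → J → 𝓢'(R3, ℂ)) (w : R3 → ℝ) : ℝ≥0∞ :=
  ⨆ f : Fin 2 → 𝓢(R3, ℂ),
    (∑' j : J, ∫⁻ x, ‖∑ l, conv (f l) (v l j) x‖ₑ ^ 2 * ‖w x‖ₑ) /
      (∑ l, ∫⁻ x, ‖f l x‖ₑ ^ 2)

/-! ### The photon Fock space -/

/-- A photon mode `(k, λ)`: momentum and polarization index. -/
abbrev Mode : Type := R3 × Fin 2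

/-- `∫ dk ∑_λ` -/
def modeMeasure : Measure Mode := (volume : Measure R3).prod Measure.count

/-- The measure on `n`-photon configurations. -/
def photonMeasure (n : ℕ) : Measure (Fin n → Mode) := Measure.pi fun _ => modeMeasure

/-- A sequence of `n`-photon amplitudes, `n = 0, 1, 2, …`. -/
abbrev FockSeq : Type := ∀ n : ℕ, (Fin n → Mode) → ℂ

/-- `‖Ψ‖² = ∑_n ∫ |Ψ_n|²`, with value `∞` if the sequence is not in Fock space. -/
def normSq (Ψ : FockSeq) : ℝ≥0∞ := ∑' n, ∫⁻ x, ‖Ψ n x‖ₑ ^ 2 ∂photonMeasure n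

/-- `Ψ` is (a representative of) a vector in the bosonic Fock space: each `Ψ_n` is measurable and
symmetric in the pairs `(k_i, λ_i)`, up to null sets, and `∑_n ∫ |Ψ_n|² < ∞`. -/
structure IsFockVector (Ψ : FockSeq) : Prop where
  measurable : ∀ n, AEStronglyMeasurable (Ψ n) (photonMeasure n)
  symmetric : ∀ (n : ℕ) (σ : Equiv.Perm (Fin n)),
    (fun x => Ψ n (fun i => x (σ i))) =ᵐ[photonMeasure n] Ψ n
  normSq_lt_top : normSq Ψ < ∞

/-- The annihilation operator `∑_λ ∫ g_λ(k) a_λ(k) dk`, where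
`(a_λ(k) Ψ)_n = √(n+1) Ψ_{n+1}(⋯, (k, λ))`. -/
def annihilate (g : Fin 2 → R3 → ℂ) (Ψ : FockSeq) : FockSeq := fun n x =>
  (Real.sqrt (n + 1) : ℂ) *
    ∑ l, ∫ k : R3, g l k * Ψ (n + 1) (Fin.snoc (α := fun _ => Mode) x (k, l))

/-- The creation operator `∑_λ ∫ g_λ(k) a*_λ(k) dk`, the formal adjoint of `annihilate (conj g)`. -/
def create (g : Fin 2 → R3 → ℂ) (Ψ : FockSeq) : FockSeq
  | 0, _ => 0
  | n + 1, x => ((Real.sqrt (n + 1))⁻¹ : ℂ) *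
      ∑ i : Fin (n + 1), g (x i).2 (x i).1 * Ψ n (fun m => x (i.succAbove m))

/-- The quadratic form `(Ψ, H_f Ψ) ∈ [0, ∞]` of the field energy `H_f = ∑_λ ∫ |k| a*_λ(k) a_λ(k) dk`,
which multiplies the `n`-photon amplitude by `|k_1| + ⋯ + |k_n|`. -/
def fieldEnergy (Ψ : FockSeq) : ℝ≥0∞ :=
  ∑' n, ∫⁻ x, ENNReal.ofReal (∑ i, ‖(x i).1‖) * ‖Ψ n x‖ₑ ^ 2 ∂photonMeasure n

/-! ### The field modes -/

/-- The smearing function `1_{|k| < Λ} √|k| vhat_λ(k) exp(i k·y)`. -/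
def modeFunction (Λ : ℝ) (vhat : Fin 2 → R3 → ℂ) (y : R3) (l : Fin 2) (k : R3) : ℂ :=
  (Metric.ball (0 : R3) Λ).indicator
    (fun k => (Real.sqrt ‖k‖ : ℂ) * vhat l k * Complex.exp (Complex.I * (inner ℝ k y : ℝ))) k

/-- `L(y) = ∑_λ ∫_{|k| < Λ} √|k| vhat_λ(k) exp(i k·y) a_λ(k) dk`. -/
def fieldL (Λ : ℝ) (vhat : Fin 2 → R3 → ℂ) (y : R3) (Ψ : FockSeq) : FockSeq :=
  annihilate (modeFunction Λ vhat y) Ψ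

/-- The adjoint `L*(y)`. -/
def fieldLstar (Λ : ℝ) (vhat : Fin 2 → R3 → ℂ) (y : R3) (Ψ : FockSeq) : FockSeq :=
  create (fun l k => conj (modeFunction Λ vhat y l k)) Ψ

/-- `ε_1, ε_2` are real measurable polarization vectors: for `k ≠ 0`, the vectors `ε_1(k)`,
`ε_2(k)` are orthonormal and perpendicular to `k`. -/
structure IsPolarization (ε : Fin 2 → R3 → R3) : Prop where
  measurable : ∀ l, Measurable (ε l)
  orthonormal : ∀ k, k ≠ 0 → Orthonormal ℝ (fun l => ε l k)
  perp : ∀ l k, k ≠ 0 → inner ℝ k (ε l k) = 0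

/-- The coefficient `1_{|k| ≤ Λ} (k ∧ ε_λ(k))_j / √|k| · exp(i k·x)`. -/
def magneticMode (Λ : ℝ) (ε : Fin 2 → R3 → R3) (j : Fin 3) (x : R3) (l : Fin 2) (k : R3) : ℂ :=
  (Metric.closedBall (0 : R3) Λ).indicator
    (fun k => ((crossProduct k.ofLp (ε l k).ofLp j / Real.sqrt ‖k‖ : ℝ) : ℂ) *
      Complex.exp (Complex.I * (inner ℝ k x : ℝ))) k

/-- The `j`-th component of the magnetic field with ultraviolet cutoff,
`B^Λ(x) = (i/2π) ∑_λ ∫_{|k| ≤ Λ} (k ∧ ε_λ(k))/√|k| (a_λ(k) e^{ik·x} - a*_λ(k) e^{-ik·x}) dk`. -/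
def magneticField (Λ : ℝ) (ε : Fin 2 → R3 → R3) (j : Fin 3) (x : R3) (Ψ : FockSeq) : FockSeq :=
  (Complex.I / (2 * Real.pi)) •
    (annihilate (magneticMode Λ ε j x) Ψ - create (magneticMode Λ ε j (-x)) Ψ)

end FieldEnergy

end

/-!
Let `ĝ_j(y)` be the one-photon function that `L_j(y)` annihilates. By Fourier transform, and by the
density of test functions supported in the punctured ball `0 < |k| < Λ`, the condition `‖w‖_v ≤ 1`
says that the one-photon operator `∑_j ∫ |w(y)| |ĝ_j(y)⟩⟨ĝ_j(y)| dy` is at most multiplication by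
`|k|`. Applied to the last photon of each amplitude of `Ψ`, this yields (a), since by symmetry the
field energy and `‖a(g) Ψ‖²` are both `n` times their contribution from the last photon.

For (b), `‖(a + c a*) Ψ‖² ≤ 2 ‖a Ψ‖² + 2 ‖a* Ψ‖²`, and the commutation relation gives
`‖a*(ḡ) Ψ‖² = ‖a(g) Ψ‖² + ‖g‖² ‖Ψ‖²`. For (c), the one-photon bound is Plancherel's theorem together
with the orthogonality of the vectors `k ∧ ε_λ(k)`, which have length `|k|`.
-/

namespace FieldEnergy

open Filter Topology

noncomputable section

section SquareIntegrable

variable {α E 𝕜 : Type*} [MeasurableSpace α] {ν : Measure α} [NormedAddCommGroup E] [RCLike 𝕜]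

theorem eLpNorm_two_sq (f : α → E) : eLpNorm f 2 ν ^ 2 = ∫⁻ x, ‖f x‖ₑ ^ 2 ∂ν := by
  simpa using eLpNorm_nnreal_pow_eq_lintegral (f := f) (μ := ν) (p := 2) two_ne_zero

theorem memLp_two_iff_lintegral {f : α → E} :
    MemLp f 2 ν ↔ AEStronglyMeasurable f ν ∧ ∫⁻ x, ‖f x‖ₑ ^ 2 ∂ν < ∞ := by
  rw [← eLpNorm_two_sq, ENNReal.pow_lt_top_iff, or_iff_left two_ne_zero, MemLp]

theorem memLp_conj {f : α → 𝕜} {p : ℝ≥0∞} (hf : MemLp f p ν) :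
    MemLp (fun x => conj (f x)) p ν :=
  hf.star

theorem integral_conj_mul_self {f : α → 𝕜} (hf : AEStronglyMeasurable f ν) :
    ∫ x, conj (f x) * f x ∂ν = ((∫⁻ x, ‖f x‖ₑ ^ 2 ∂ν).toReal : 𝕜) := by
  have hsq (x : α) : conj (f x) * f x = ((‖f x‖ ^ 2 : ℝ) : 𝕜) := by
    rw [RCLike.conj_mul, RCLike.ofReal_pow]
  simp_rw [hsq]
  rw [integral_ofReal, integral_eq_lintegral_of_nonneg_ae
    (Eventually.of_forall fun x => sq_nonneg ‖f x‖) (hf.norm.pow 2)]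
  simp_rw [ENNReal.ofReal_pow (norm_nonneg _), ofReal_norm]

theorem toReal_lintegral_sum_sq {ι : Type*} [Fintype ι] {T : ι → α → 𝕜}
    (hT : ∀ i, MemLp (T i) 2 ν) :
    ((∫⁻ x, ‖∑ i, T i x‖ₑ ^ 2 ∂ν).toReal : 𝕜) = ∑ i, ∑ j, ∫ x, conj (T i x) * T j x ∂ν := by
  have hint (i j : ι) : Integrable (fun x => conj (T i x) * T j x) ν :=
    (hT i).star.integrable_mul (hT j)
  rw [← integral_conj_mul_self (memLp_finsetSum _ fun i _ => hT i).1]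
  simp_rw [map_sum, Finset.sum_mul_sum]
  rw [integral_finsetSum _ fun i _ => integrable_finsetSum _ fun j _ => hint i j]
  exact Finset.sum_congr rfl fun i _ => integral_finsetSum _ fun j _ => hint i j

theorem enorm_integral_mul_le {f g : α → 𝕜} (hf : AEStronglyMeasurable f ν)
    (hg : AEStronglyMeasurable g ν) :
    ‖∫ x, f x * g x ∂ν‖ₑ ≤ eLpNorm f 2 ν * eLpNorm g 2 ν :=
  calc ‖∫ x, f x * g x ∂ν‖ₑ ≤ eLpNorm (f • g) 1 ν := by
        rw [eLpNorm_one_eq_lintegral_enorm]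
        exact enorm_integral_le_lintegral_enorm _
    _ ≤ eLpNorm f 2 ν * eLpNorm g 2 ν := eLpNorm_smul_le_mul_eLpNorm hg hf

theorem tendsto_integral_mul_of_tendsto_eLpNorm {ι : Type*} {L : Filter ι} {f g : α → 𝕜}
    {χ : ι → α → 𝕜} (hf : MemLp f 2 ν) (hg : MemLp g 2 ν) (hχ : ∀ i, MemLp (χ i) 2 ν)
    (hlim : Tendsto (fun i => eLpNorm (χ i - g) 2 ν) L (𝓝 0)) :
    Tendsto (fun i => ∫ x, f x * χ i x ∂ν) L (𝓝 (∫ x, f x * g x ∂ν)) := by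
  have hbound (i : ι) :
      edist (∫ x, f x * χ i x ∂ν) (∫ x, f x * g x ∂ν) ≤ eLpNorm f 2 ν * eLpNorm (χ i - g) 2 ν := by
    have hsub := integral_sub (hf.integrable_mul (hχ i)) (hf.integrable_mul hg)
    simp only [Pi.mul_apply, ← mul_sub] at hsub
    rw [edist_eq_enorm_sub, ← hsub]
    exact enorm_integral_mul_le hf.1 ((hχ i).1.sub hg.1)
  have hzero : Tendsto (fun i => eLpNorm f 2 ν * eLpNorm (χ i - g) 2 ν) L (𝓝 0) := by
    simpa using ENNReal.Tendsto.const_mul hlim (Or.inr hf.2.ne)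
  exact tendsto_iff_edist_tendsto_0.2 (tendsto_of_tendsto_of_tendsto_of_le_of_le
    tendsto_const_nhds hzero (fun _ => zero_le) hbound)

end SquareIntegrable

section SumsOfIntegrals

variable {α J : Type*} [MeasurableSpace α] {ν : Measure α}

theorem sum_lintegral_le_lintegral_sum (s : Finset J) (F : J → α → ℝ≥0∞) :
    ∑ j ∈ s, ∫⁻ x, F j x ∂ν ≤ ∫⁻ x, ∑ j ∈ s, F j x ∂ν := by
  classical
  induction s using Finset.induction_on with
  | empty => simp
  | insert j s hj ih =>
    simp_rw [Finset.sum_insert hj]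
    exact (add_le_add_right ih _).trans (le_lintegral_add _ _)

theorem tsum_lintegral_le_lintegral_tsum (F : J → α → ℝ≥0∞) :
    ∑' j, ∫⁻ x, F j x ∂ν ≤ ∫⁻ x, ∑' j, F j x ∂ν := by
  rw [ENNReal.tsum_eq_iSup_sum]
  exact iSup_le fun s => (sum_lintegral_le_lintegral_sum s F).trans
    (lintegral_mono fun x => ENNReal.sum_le_tsum s)

theorem tsum_lintegral_le_of_tendsto {F : ℕ → J → α → ℝ≥0∞} {G : J → α → ℝ≥0∞} {R : ℕ → ℝ≥0∞}
    {r : ℝ≥0∞} (hF : ∀ n j, AEMeasurable (F n j) ν)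
    (hlim : ∀ j x, Tendsto (fun n => F n j x) atTop (𝓝 (G j x)))
    (hle : ∀ n, ∑' j, ∫⁻ x, F n j x ∂ν ≤ R n) (hR : Tendsto R atTop (𝓝 r)) :
    ∑' j, ∫⁻ x, G j x ∂ν ≤ r :=
  calc ∑' j, ∫⁻ x, G j x ∂ν ≤ ∑' j, liminf (fun n => ∫⁻ x, F n j x ∂ν) atTop := by
        gcongr with j
        simp_rw [← (hlim j _).liminf_eq]
        exact lintegral_liminf_le' fun n => hF n j
    _ ≤ liminf (fun n => ∑' j, ∫⁻ x, F n j x ∂ν) atTop := by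
        let _ : MeasurableSpace J := ⊤
        simp_rw [← lintegral_count]
        exact lintegral_liminf_le fun n => measurable_from_top
    _ ≤ liminf R atTop := liminf_le_liminf (Eventually.of_forall hle)
    _ = r := hR.liminf_eq

end SumsOfIntegrals

section EnormDensity

variable {α : Type*} [MeasurableSpace α] {μ : Measure α} {w : α → ℝ}

theorem lintegral_withDensity_enorm (hw : AEStronglyMeasurable w μ) (F : α → ℝ≥0∞) :
    ∫⁻ y, F y ∂μ.withDensity (fun y => ‖w y‖ₑ) = ∫⁻ y, ‖w y‖ₑ * F y ∂μ :=
  lintegral_withDensity_eq_lintegral_mul_non_measurable₀ μ hw.enorm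
    (Eventually.of_forall fun _ => enorm_lt_top) F

theorem withDensity_enorm_le (hw : ∀ y, ‖w y‖ₑ ≤ 1) : μ.withDensity (fun y => ‖w y‖ₑ) ≤ μ :=
  (withDensity_mono (Eventually.of_forall hw)).trans_eq withDensity_one

end EnormDensity

section Configurations

variable {M : Type*}

/-- The configuration `(x₁, …, xₙ, p)`: the particle `p` is added to the configuration `x`. -/
abbrev addParticle {n : ℕ} (x : Fin n → M) (p : M) : Fin (n + 1) → M :=
  Fin.snoc (α := fun _ => M) x p

theorem exists_perm_succAbove {n : ℕ} (σ : Equiv.Perm (Fin (n + 1))) (i : Fin (n + 1)) :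
    ∃ τ : Equiv.Perm (Fin n), ∀ m, σ (i.succAbove m) = (σ i).succAbove (τ m) := by
  let e : {j // j ≠ i} ≃ {j // j ≠ σ i} := σ.subtypeEquiv fun j => σ.injective.ne_iff.symm
  refine ⟨((finSuccAboveEquiv i).trans e).trans (finSuccAboveEquiv (σ i)).symm, fun m => ?_⟩
  exact (congrArg Subtype.val
    ((finSuccAboveEquiv (σ i)).apply_symm_apply (e (finSuccAboveEquiv i m)))).symm

section TensorTerm

variable {R : Type*} [Mul R] {n : ℕ}

/-- The function `x ↦ G(xᵢ) ψ(x₁, …, x̂ᵢ, …, xₙ₊₁)`; summed over `i` these are the terms of the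
symmetrized tensor product of the one-particle function `G` with `ψ`. -/
def tensorTerm (G : M → R) (ψ : (Fin n → M) → R) (i : Fin (n + 1)) (x : Fin (n + 1) → M) : R :=
  G (x i) * ψ fun m => x (i.succAbove m)

theorem tensorTerm_last_addParticle (G : M → R) (ψ : (Fin n → M) → R) (z : Fin n → M) (q : M) :
    tensorTerm G ψ (Fin.last n) (addParticle z q) = G q * ψ z := by
  simp [tensorTerm]

theorem tensorTerm_castSucc_last_addParticle (G : M → R) (ψ : (Fin (n + 1) → M) → R)
    (z : Fin n → M) (p q : M) :
    tensorTerm G ψ (Fin.last n).castSucc (addParticle (addParticle z p) q) =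
      G p * ψ (addParticle z q) := by
  have hdrop : (fun m => addParticle (addParticle z p) q ((Fin.last n).castSucc.succAbove m)) =
      addParticle z q := by
    funext m
    cases m using Fin.lastCases with
    | last => simp
    | cast m =>
      rw [Fin.succAbove_of_castSucc_lt _ _ (by simp [Fin.lt_def])]
      simp
  simp only [tensorTerm, hdrop, Fin.snoc_castSucc, Fin.snoc_last]

end TensorTerm

variable [MeasurableSpace M] {μ : Measure M} {n : ℕ}

/-- The product measure on the configurations of `n` particles. -/
abbrev configMeasure (μ : Measure M) (n : ℕ) : Measure (Fin n → M) := Measure.pi fun _ => μ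

/-- Bosonic symmetry: up to null sets, `ψ` is invariant under permutations of the particles. -/
def IsPermInvariant {β : Type*} (μ : Measure M) (ψ : (Fin n → M) → β) : Prop :=
  ∀ σ : Equiv.Perm (Fin n), (fun x => ψ fun i => x (σ i)) =ᵐ[configMeasure μ n] ψ

theorem IsPermInvariant.comp {β γ : Type*} {ψ : (Fin n → M) → β} (hψ : IsPermInvariant μ ψ)
    (g : β → γ) : IsPermInvariant μ fun x => g (ψ x) :=
  fun σ => (hψ σ).fun_comp g

theorem measurableEmbedding_perm (σ : Equiv.Perm (Fin n)) :
    MeasurableEmbedding fun (x : Fin n → M) i => x (σ i) :=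
  (MeasurableEquiv.arrowCongr' σ.symm (MeasurableEquiv.refl M)).measurableEmbedding

variable [SigmaFinite μ]

theorem measurePreserving_perm (σ : Equiv.Perm (Fin n)) :
    MeasurePreserving (fun (x : Fin n → M) i => x (σ i)) (configMeasure μ n) (configMeasure μ n) :=
  measurePreserving_arrowCongr' (fun _ : Fin n => μ) (fun _ => μ) σ.symm (MeasurableEquiv.refl M)
    fun _ => MeasurePreserving.id μ

theorem measurePreserving_addParticle (μ : Measure M) [SigmaFinite μ] (n : ℕ) :
    MeasurePreserving (fun q : (Fin n → M) × M => addParticle q.1 q.2)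
      ((configMeasure μ n).prod μ) (configMeasure μ (n + 1)) := by
  have h := ((measurePreserving_piFinSuccAbove (fun _ : Fin (n + 1) => μ) (Fin.last n)).symm).comp
    (Measure.measurePreserving_swap (μ := configMeasure μ n) (ν := μ))
  convert h using 1
  funext q
  simp [MeasurableEquiv.piFinSuccAbove, Fin.insertNthEquiv]

theorem quasiMeasurePreserving_succAbove (i : Fin (n + 1)) :
    Measure.QuasiMeasurePreserving (fun (x : Fin (n + 1) → M) m => x (i.succAbove m))
      (configMeasure μ (n + 1)) (configMeasure μ n) :=
  Measure.quasiMeasurePreserving_snd.comp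
    (measurePreserving_piFinSuccAbove (fun _ : Fin (n + 1) => μ) i).quasiMeasurePreserving

theorem lintegral_addParticle {f : (Fin (n + 1) → M) → ℝ≥0∞}
    (hf : AEMeasurable f (configMeasure μ (n + 1))) :
    ∫⁻ x, f x ∂configMeasure μ (n + 1) =
      ∫⁻ z, ∫⁻ p, f (addParticle z p) ∂μ ∂configMeasure μ n := by
  have h := measurePreserving_addParticle μ n
  rw [← h.map_eq, lintegral_map' (h.map_eq ▸ hf) h.aemeasurable]
  exact lintegral_prod _ (hf.comp_quasiMeasurePreserving h.quasiMeasurePreserving)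

section Integral

variable {E : Type*} [NormedAddCommGroup E] {f : (Fin (n + 1) → M) → E}

theorem integrable_comp_addParticle (hf : Integrable f (configMeasure μ (n + 1))) :
    Integrable (fun q : (Fin n → M) × M => f (addParticle q.1 q.2))
      ((configMeasure μ n).prod μ) :=
  ((measurePreserving_addParticle μ n).integrable_comp hf.1).2 hf

variable [NormedSpace ℝ E]

theorem integrable_integral_addParticle (hf : Integrable f (configMeasure μ (n + 1))) :
    Integrable (fun z => ∫ p, f (addParticle z p) ∂μ) (configMeasure μ n) :=
  (integrable_comp_addParticle hf).integral_prod_left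

theorem integral_addParticle (hf : Integrable f (configMeasure μ (n + 1))) :
    ∫ x, f x ∂configMeasure μ (n + 1) =
      ∫ z, ∫ p, f (addParticle z p) ∂μ ∂configMeasure μ n := by
  have h := measurePreserving_addParticle μ n
  rw [← h.map_eq, integral_map h.aemeasurable (h.map_eq.symm ▸ hf.1)]
  exact integral_prod _ (integrable_comp_addParticle hf)

end Integral

theorem lintegral_sum_mul_of_isPermInvariant {e : M → ℝ≥0∞} (he : Measurable e)
    {f : (Fin (n + 1) → M) → ℝ≥0∞} (hf : AEMeasurable f (configMeasure μ (n + 1)))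
    (hsymm : IsPermInvariant μ f) :
    ∫⁻ x, (∑ i, e (x i)) * f x ∂configMeasure μ (n + 1) =
      (n + 1) * ∫⁻ z, ∫⁻ p, e p * f (addParticle z p) ∂μ ∂configMeasure μ n := by
  have hmeas (i : Fin (n + 1)) : AEMeasurable (fun x : Fin (n + 1) → M => e (x i) * f x)
      (configMeasure μ (n + 1)) := (he.comp (measurable_pi_apply i)).aemeasurable.mul hf
  have hlast (i : Fin (n + 1)) : ∫⁻ x, e (x i) * f x ∂configMeasure μ (n + 1) =
      ∫⁻ x, e (x (Fin.last n)) * f x ∂configMeasure μ (n + 1) := by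
    rw [← (measurePreserving_perm (Equiv.swap i (Fin.last n))).lintegral_comp_emb
      (measurableEmbedding_perm _) fun x => e (x i) * f x]
    refine lintegral_congr_ae ?_
    filter_upwards [hsymm (Equiv.swap i (Fin.last n))] with x hx
    rw [hx, Equiv.swap_apply_left]
  simp_rw [Finset.sum_mul]
  rw [lintegral_finsetSum' _ fun i _ => hmeas i, Finset.sum_congr rfl fun i _ => hlast i,
    Finset.sum_const, lintegral_addParticle (hmeas _)]
  simp

section Contraction

variable {𝕜 : Type*} [RCLike 𝕜] {G : M → 𝕜}

/-- The contraction `z ↦ ∫ G(p) ψ(z, p) dμ(p)` of the last particle of `ψ` against `G`. -/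
def contract (μ : Measure M) (G : M → 𝕜) (ψ : (Fin (n + 1) → M) → 𝕜) (z : Fin n → M) : 𝕜 :=
  ∫ p, G p * ψ (addParticle z p) ∂μ

theorem memLp_contract (hG : MemLp G 2 μ) {ψ : (Fin (n + 1) → M) → 𝕜}
    (hψ : MemLp ψ 2 (configMeasure μ (n + 1))) :
    MemLp (contract μ G ψ) 2 (configMeasure μ n) := by
  have hψs : AEStronglyMeasurable (fun q : (Fin n → M) × M => ψ (addParticle q.1 q.2))
      ((configMeasure μ n).prod μ) :=
    hψ.1.comp_measurePreserving (measurePreserving_addParticle μ n)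
  have hG' := memLp_two_iff_lintegral.1 hG
  refine memLp_two_iff_lintegral.2 ⟨(hG.1.comp_snd.mul hψs).integral_prod_right', ?_⟩
  calc ∫⁻ z, ‖contract μ G ψ z‖ₑ ^ 2 ∂configMeasure μ n
      ≤ ∫⁻ z, (∫⁻ p, ‖G p‖ₑ ^ 2 ∂μ) * ∫⁻ p, ‖ψ (addParticle z p)‖ₑ ^ 2 ∂μ
          ∂configMeasure μ n := by
        refine lintegral_mono_ae (hψs.prodMk_left.mono fun z hz => ?_)
        grw [contract, enorm_integral_mul_le hG.1 hz, mul_pow, eLpNorm_two_sq, eLpNorm_two_sq]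
    _ = (∫⁻ p, ‖G p‖ₑ ^ 2 ∂μ) * ∫⁻ x, ‖ψ x‖ₑ ^ 2 ∂configMeasure μ (n + 1) := by
        rw [lintegral_const_mul' _ _ hG'.2.ne, lintegral_addParticle (hψ.1.enorm.pow_const 2)]
    _ < ∞ := ENNReal.mul_lt_top hG'.2 (memLp_two_iff_lintegral.1 hψ).2

theorem tensorTerm_perm (G : M → 𝕜) {ψ : (Fin n → M) → 𝕜} (hsymm : IsPermInvariant μ ψ)
    (σ : Equiv.Perm (Fin (n + 1))) (i : Fin (n + 1)) :
    (fun x => tensorTerm G ψ i fun m => x (σ m)) =ᵐ[configMeasure μ (n + 1)]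
      tensorTerm G ψ (σ i) := by
  obtain ⟨τ, hτ⟩ := exists_perm_succAbove σ i
  filter_upwards [(quasiMeasurePreserving_succAbove (σ i)).ae (hsymm τ)] with x hx
  simp only [tensorTerm, hτ]
  rw [hx]

theorem lintegral_tensorTerm_sq (hG : AEStronglyMeasurable G μ) {ψ : (Fin n → M) → 𝕜}
    (hψ : AEStronglyMeasurable ψ (configMeasure μ n)) (i : Fin (n + 1)) :
    ∫⁻ x, ‖tensorTerm G ψ i x‖ₑ ^ 2 ∂configMeasure μ (n + 1) =
      (∫⁻ p, ‖G p‖ₑ ^ 2 ∂μ) * ∫⁻ x, ‖ψ x‖ₑ ^ 2 ∂configMeasure μ n := by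
  rw [← lintegral_prod_mul (hG.enorm.pow_const 2) (hψ.enorm.pow_const 2),
    ← (measurePreserving_piFinSuccAbove (fun _ : Fin (n + 1) => μ) i).lintegral_comp_emb
      (MeasurableEquiv.measurableEmbedding _)]
  refine lintegral_congr fun x => ?_
  rw [← mul_pow, tensorTerm, enorm_mul]
  rfl

theorem memLp_tensorTerm (hG : MemLp G 2 μ) {ψ : (Fin n → M) → 𝕜}
    (hψ : MemLp ψ 2 (configMeasure μ n)) (i : Fin (n + 1)) :
    MemLp (tensorTerm G ψ i) 2 (configMeasure μ (n + 1)) := by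
  rw [memLp_two_iff_lintegral] at hG hψ ⊢
  refine ⟨(hG.1.comp_quasiMeasurePreserving (Measure.quasiMeasurePreserving_eval _ i)).mul
    (hψ.1.comp_quasiMeasurePreserving (quasiMeasurePreserving_succAbove i)), ?_⟩
  rw [lintegral_tensorTerm_sq hG.1 hψ.1]
  exact ENNReal.mul_lt_top hG.2 hψ.2

theorem integral_conj_tensorTerm_mul_perm {ψ : (Fin n → M) → 𝕜} (hsymm : IsPermInvariant μ ψ)
    (σ : Equiv.Perm (Fin (n + 1))) (i j : Fin (n + 1)) :
    ∫ x, conj (tensorTerm G ψ (σ i) x) * tensorTerm G ψ (σ j) x ∂configMeasure μ (n + 1) =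
      ∫ x, conj (tensorTerm G ψ i x) * tensorTerm G ψ j x ∂configMeasure μ (n + 1) := by
  rw [← (measurePreserving_perm σ).integral_comp (measurableEmbedding_perm _) fun x =>
    conj (tensorTerm G ψ i x) * tensorTerm G ψ j x]
  refine integral_congr_ae ?_
  filter_upwards [tensorTerm_perm G hsymm σ i, tensorTerm_perm G hsymm σ j] with x hi hj
  rw [hi, hj]

variable {ψ : (Fin (n + 1) → M) → 𝕜}

theorem integral_conj_tensorTerm_last_mul (hG : MemLp G 2 μ)
    (hψ : MemLp ψ 2 (configMeasure μ (n + 1))) :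
    ∫ x, conj (tensorTerm G ψ (Fin.last (n + 1)) x) * tensorTerm G ψ (Fin.last n).castSucc x
        ∂configMeasure μ (n + 2) =
      ((∫⁻ z, ‖contract μ (fun p => conj (G p)) ψ z‖ₑ ^ 2 ∂configMeasure μ n).toReal : 𝕜) := by
  have hint : Integrable (fun x => conj (tensorTerm G ψ (Fin.last (n + 1)) x) *
      tensorTerm G ψ (Fin.last n).castSucc x) (configMeasure μ (n + 2)) :=
    (memLp_tensorTerm hG hψ (Fin.last (n + 1))).star.integrable_mul (memLp_tensorTerm hG hψ _)
  rw [integral_addParticle hint, integral_addParticle (integrable_integral_addParticle hint),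
    ← integral_conj_mul_self (memLp_contract (memLp_conj hG) hψ).1]
  refine integral_congr_ae (Eventually.of_forall fun z => ?_)
  simp only [tensorTerm_last_addParticle, tensorTerm_castSucc_last_addParticle, contract]
  rw [← integral_conj, ← integral_mul_const]
  refine integral_congr_ae (Eventually.of_forall fun p => ?_)
  simp only [map_mul, RCLike.conj_conj]
  rw [← integral_const_mul]
  refine integral_congr_ae (Eventually.of_forall fun q => ?_)
  ring

theorem integral_conj_tensorTerm_mul_of_ne (hG : MemLp G 2 μ)
    (hψ : MemLp ψ 2 (configMeasure μ (n + 1))) (hsymm : IsPermInvariant μ ψ)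
    {i j : Fin (n + 2)} (hij : i ≠ j) :
    ∫ x, conj (tensorTerm G ψ i x) * tensorTerm G ψ j x ∂configMeasure μ (n + 2) =
      ((∫⁻ z, ‖contract μ (fun p => conj (G p)) ψ z‖ₑ ^ 2 ∂configMeasure μ n).toReal : 𝕜) := by
  obtain ⟨σ, rfl, rfl⟩ : ∃ σ : Equiv.Perm (Fin (n + 2)),
      σ (Fin.last (n + 1)) = i ∧ σ (Fin.last n).castSucc = j :=
    MulAction.is_two_pretransitive_iff.1
      (Equiv.Perm.isMultiplyPretransitive (Fin (n + 2)) 2) (Fin.castSucc_lt_last _).ne' hij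
  rw [integral_conj_tensorTerm_mul_perm hsymm, integral_conj_tensorTerm_last_mul hG hψ]

theorem sum_integral_conj_tensorTerm_mul (hG : MemLp G 2 μ)
    (hψ : MemLp ψ 2 (configMeasure μ (n + 1))) (hsymm : IsPermInvariant μ ψ) (i : Fin (n + 2)) :
    ∑ j, ∫ x, conj (tensorTerm G ψ i x) * tensorTerm G ψ j x ∂configMeasure μ (n + 2) =
      (((∫⁻ p, ‖G p‖ₑ ^ 2 ∂μ) * ∫⁻ x, ‖ψ x‖ₑ ^ 2 ∂configMeasure μ (n + 1)).toReal : 𝕜) +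
        (n + 1) *
          ((∫⁻ z, ‖contract μ (fun p => conj (G p)) ψ z‖ₑ ^ 2 ∂configMeasure μ n).toReal : 𝕜) := by
  rw [← Finset.add_sum_erase _ _ (Finset.mem_univ i),
    integral_conj_mul_self (memLp_tensorTerm hG hψ i).1, lintegral_tensorTerm_sq hG.1 hψ.1,
    Finset.sum_congr rfl fun j hj =>
      integral_conj_tensorTerm_mul_of_ne hG hψ hsymm (Finset.ne_of_mem_erase hj).symm]
  simp

theorem lintegral_sum_tensorTerm_sq (hG : MemLp G 2 μ)
    (hψ : MemLp ψ 2 (configMeasure μ (n + 1))) (hsymm : IsPermInvariant μ ψ) :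
    ∫⁻ x, ‖∑ i, tensorTerm G ψ i x‖ₑ ^ 2 ∂configMeasure μ (n + 2) =
      (n + 2) * ((∫⁻ p, ‖G p‖ₑ ^ 2 ∂μ) * ∫⁻ x, ‖ψ x‖ₑ ^ 2 ∂configMeasure μ (n + 1) +
        (n + 1) * ∫⁻ z, ‖contract μ (fun p => conj (G p)) ψ z‖ₑ ^ 2 ∂configMeasure μ n) := by
  have hT := memLp_tensorTerm hG hψ
  have hsum : MemLp (fun x => ∑ i, tensorTerm G ψ i x) 2 (configMeasure μ (n + 2)) :=
    memLp_finsetSum _ fun i _ => hT i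
  have hdiag := ENNReal.mul_lt_top (memLp_two_iff_lintegral.1 hG).2 (memLp_two_iff_lintegral.1 hψ).2
  have hoff := ENNReal.mul_lt_top (by finiteness : (n + 1 : ℝ≥0∞) < ∞)
    (memLp_two_iff_lintegral.1 (memLp_contract (memLp_conj hG) hψ)).2
  have hright := ENNReal.mul_lt_top (by finiteness : (n + 2 : ℝ≥0∞) < ∞)
    (ENNReal.add_lt_top.2 ⟨hdiag, hoff⟩)
  have hnat (m k : ℕ) : ((m : ℝ≥0∞) + k).toReal = m + k := by
    exact_mod_cast ENNReal.toReal_natCast (m + k)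
  have hone := hnat n 1
  have htwo := hnat n 2
  push_cast at hone htwo
  rw [← ENNReal.toReal_eq_toReal_iff' (memLp_two_iff_lintegral.1 hsum).2.ne hright.ne,
    ← RCLike.ofReal_inj (K := 𝕜),
    toReal_lintegral_sum_sq hT,
    Finset.sum_congr rfl fun i _ => sum_integral_conj_tensorTerm_mul hG hψ hsymm i]
  simp only [Finset.sum_const, Finset.card_univ, Fintype.card_fin, nsmul_eq_mul,
    ENNReal.toReal_mul, ENNReal.toReal_add hdiag.ne hoff.ne, hone, htwo]
  push_cast
  ring

end Contraction

end Configurations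

section Fourier

variable {V : Type*} [NormedAddCommGroup V] [InnerProductSpace ℝ V]

/-- The plane wave `k ↦ exp(i k·y)`. -/
def planeWave (y k : V) : ℂ := Complex.exp (Complex.I * (inner ℝ k y : ℝ))

theorem enorm_planeWave (y k : V) : ‖planeWave y k‖ₑ = 1 := by
  rw [← ofReal_norm, planeWave, Complex.norm_exp_I_mul_ofReal, ENNReal.ofReal_one]

theorem continuous_planeWave_uncurry : Continuous fun q : V × V => planeWave q.1 q.2 := by
  unfold planeWave
  fun_prop

theorem continuous_planeWave (y : V) : Continuous (planeWave y) := by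
  unfold planeWave
  fun_prop

theorem contDiff_planeWave (y : V) {n : WithTop ℕ∞} : ContDiff ℝ n (planeWave y) :=
  Complex.contDiff_exp.comp
    (contDiff_const.mul (Complex.ofRealCLM.contDiff.comp (contDiff_id.inner ℝ contDiff_const)))

variable [FiniteDimensional ℝ V] [MeasurableSpace V] [BorelSpace V]

section L2

open scoped ContDiff

theorem fourier_toLp_ae_eq {h : V → ℂ} (hint : Integrable h) (hsq : MemLp h 2) :
    (𝓕 (hsq.toLp h) : Lp (α := V) ℂ 2) =ᵐ[volume] 𝓕 h := by
  have hcont : Continuous (𝓕 h) := VectorFourier.fourierIntegral_continuous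
    Real.continuous_fourierChar (innerSL ℝ).continuous₂ hint
  -- Test both sides on smooth functions: as a tempered distribution, `𝓕 (hsq.toLp h)` is defined by
  -- duality, and moving `𝓕` back from the test function to `h` only needs `h` to be integrable.
  refine ae_eq_of_integral_contDiff_smul_eq
    ((Lp.memLp _).locallyIntegrable one_le_two) hcont.locallyIntegrable fun g hg hgc => ?_
  have hcompact : HasCompactSupport (Complex.ofRealCLM ∘ g) := hgc.comp_left rfl
  have hsmooth : ContDiff ℝ ∞ (Complex.ofRealCLM ∘ g) := by fun_prop
  set φ := hcompact.toSchwartzMap hsmooth with hφ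
  have hdistribution :=
    congrArg (fun T : 𝓢'(V, ℂ) => T φ) (Lp.fourier_toTemperedDistribution_eq (hsq.toLp h))
  simp only [TemperedDistribution.fourier_apply, Lp.toTemperedDistribution_apply] at hdistribution
  calc ∫ x, g x • (𝓕 (hsq.toLp h) : Lp ℂ 2 (volume : Measure V)) x
      = ∫ x, φ x • (𝓕 (hsq.toLp h) : Lp ℂ 2 (volume : Measure V)) x := by simp [hφ]
    _ = ∫ x, (𝓕 φ) x • (hsq.toLp h) x := hdistribution.symm
    _ = ∫ x, (𝓕 φ) x • h x := integral_congr_ae (hsq.coeFn_toLp.mono fun x hx => by simp only [hx])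
    _ = ∫ x, φ x • 𝓕 h x := by
        rw [SchwartzMap.fourier_coe]
        have := VectorFourier.integral_fourierIntegral_smul_eq_flip (L := innerₗ V)
          Real.continuous_fourierChar (innerSL ℝ).continuous₂ (φ.integrable (μ := volume)) hint
        rwa [flip_innerₗ] at this
    _ = ∫ x, g x • 𝓕 h x := rfl

end L2

theorem lintegral_fourier_sq {h : V → ℂ} (hint : Integrable h) (hsq : MemLp h 2) :
    ∫⁻ y, ‖𝓕 h y‖ₑ ^ 2 = ∫⁻ x, ‖h x‖ₑ ^ 2 := by
  rw [← eLpNorm_two_sq, ← eLpNorm_two_sq, ← eLpNorm_congr_ae (fourier_toLp_ae_eq hint hsq),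
    ← Lp.enorm_def, ← eLpNorm_congr_ae hsq.coeFn_toLp, ← Lp.enorm_def, ← ofReal_norm,
    Lp.norm_fourier_eq, ofReal_norm]

theorem fourier_smul_eq (h : V → ℂ) (y : V) :
    𝓕 h ((-(2 * Real.pi)⁻¹ : ℝ) • y) = ∫ k, h k * planeWave y k := by
  rw [Real.fourier_eq']
  refine integral_congr_ae (Eventually.of_forall fun k => ?_)
  have hπ : (Real.pi : ℂ) ≠ 0 := by exact_mod_cast Real.pi_ne_zero
  simp only [inner_smul_right, smul_eq_mul, planeWave]
  rw [mul_comm]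
  congr 2
  push_cast
  field_simp

theorem lintegral_planeWave_sq {h : V → ℂ} (hint : Integrable h) (hsq : MemLp h 2) :
    ∫⁻ y, ‖∫ k, h k * planeWave y k‖ₑ ^ 2 =
      ENNReal.ofReal ((2 * Real.pi) ^ Module.finrank ℝ V) * ∫⁻ k, ‖h k‖ₑ ^ 2 := by
  have hcont : Continuous (𝓕 h) := VectorFourier.fourierIntegral_continuous
    Real.continuous_fourierChar (innerSL ℝ).continuous₂ hint
  have hscale : (-(2 * Real.pi)⁻¹ : ℝ) ≠ 0 := neg_ne_zero.2 (inv_ne_zero Real.two_pi_pos.ne')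
  have hmeas : Measurable fun y => ‖𝓕 h y‖ₑ ^ 2 := by fun_prop
  simp_rw [← fourier_smul_eq]
  rw [← lintegral_fourier_sq hint hsq,
    ← lintegral_map hmeas (measurable_const_smul (-(2 * Real.pi)⁻¹ : ℝ)),
    Measure.map_addHaar_smul _ hscale, lintegral_smul_measure, smul_eq_mul, abs_inv, abs_pow,
    abs_neg, abs_of_pos (inv_pos.2 Real.two_pi_pos), inv_pow, inv_inv]

end Fourier

section TestFunctions

open scoped ContDiff

variable {V : Type*} [NormedAddCommGroup V] [NormedSpace ℝ V]

/-- The smooth functions whose compact support is contained in `U`. -/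
structure IsTestFunction (U : Set V) (χ : V → ℂ) : Prop where
  contDiff : ContDiff ℝ ∞ χ
  compact : HasCompactSupport χ
  tsupport_subset : tsupport χ ⊆ U

theorem IsTestFunction.eq_zero_of_notMem {U : Set V} {χ : V → ℂ} (h : IsTestFunction U χ) {x : V}
    (hx : x ∉ U) : χ x = 0 :=
  image_eq_zero_of_notMem_tsupport fun hx' => hx (h.tsupport_subset hx')

variable [MeasurableSpace V] [BorelSpace V] (ν : Measure V)

theorem IsTestFunction.memLp [IsFiniteMeasureOnCompacts ν] {U : Set V} {χ : V → ℂ}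
    (h : IsTestFunction U χ) : MemLp χ 2 ν :=
  h.contDiff.continuous.memLp_of_hasCompactSupport h.compact

/-- The test functions in `U` as a subspace of `L²(U)`. -/
def testSubmodule (U : Set V) : Submodule ℂ (Lp ℂ 2 (ν.restrict U)) where
  carrier := {f | ∃ χ, IsTestFunction U χ ∧ f =ᵐ[ν.restrict U] χ}
  zero_mem' := ⟨0, ⟨contDiff_const, HasCompactSupport.zero, by simp⟩, Lp.coeFn_zero _ _ _⟩
  add_mem' := by
    rintro f g ⟨χ, hχ, hf⟩ ⟨η, hη, hg⟩
    exact ⟨χ + η, ⟨hχ.contDiff.add hη.contDiff, hχ.compact.add hη.compact,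
      (tsupport_add χ η).trans (Set.union_subset hχ.tsupport_subset hη.tsupport_subset)⟩,
      (Lp.coeFn_add f g).trans (hf.add hg)⟩
  smul_mem' := by
    rintro c f ⟨χ, hχ, hf⟩
    exact ⟨c • χ, ⟨contDiff_const.smul hχ.contDiff, hχ.compact.smul_left (f := fun _ => c),
      (tsupport_smul_subset_right (fun _ => c) χ).trans hχ.tsupport_subset⟩,
      (Lp.coeFn_smul c f).trans (hf.const_smul c)⟩

variable [FiniteDimensional ℝ V] [IsLocallyFiniteMeasure ν] {U : Set V}

theorem testSubmodule_orthogonal (hU : IsOpen U) : (testSubmodule ν U)ᗮ = ⊥ := by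
  refine (Submodule.eq_bot_iff _).2 fun h hh => ?_
  rw [Submodule.mem_orthogonal] at hh
  have hloc : LocallyIntegrableOn h U ν :=
    locallyIntegrableOn_of_locallyIntegrable_restrict
      ((Lp.memLp h).locallyIntegrable one_le_two)
  refine (Lp.eq_zero_iff_ae_eq_zero).2 ((ae_restrict_iff' hU.measurableSet).2
    (hU.ae_eq_zero_of_integral_contDiff_smul_eq_zero hloc fun g hg hgc hgU => ?_))
  have hχ : IsTestFunction U (fun x => (g x : ℂ)) :=
    ⟨Complex.ofRealCLM.contDiff.comp hg, hgc.comp_left Complex.ofReal_zero,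
      (closure_mono fun x hx => by simpa using hx).trans hgU⟩
  have hL := (hχ.memLp ν).restrict U
  have horth := hh (hL.toLp _) ⟨_, hχ, hL.coeFn_toLp⟩
  rw [L2.inner_def] at horth
  rw [← horth, ← setIntegral_eq_integral_of_forall_compl_eq_zero (s := U) fun x hx => ?_]
  · refine integral_congr_ae (hL.coeFn_toLp.mono fun x hx => ?_)
    simp only [hx, RCLike.inner_apply, Complex.conj_ofReal, Complex.real_smul]
    ring
  · rw [image_eq_zero_of_notMem_tsupport fun hx' => hx (hgU hx'), zero_smul]

theorem exists_testFunction_tendsto (hU : IsOpen U) {f : V → ℂ} (hf : MemLp f 2 ν)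
    (hfU : ∀ x ∉ U, f x = 0) :
    ∃ χ : ℕ → V → ℂ, (∀ n, IsTestFunction U (χ n)) ∧
      Tendsto (fun n => eLpNorm (χ n - f) 2 ν) atTop (𝓝 0) := by
  have hclosure : (hf.restrict U).toLp f ∈ (testSubmodule ν U).topologicalClosure := by
    rw [(testSubmodule ν U).topologicalClosure_eq_top_iff.2 (testSubmodule_orthogonal ν hU)]
    trivial
  obtain ⟨g, hg, hlim⟩ := mem_closure_iff_seq_limit.1 hclosure
  choose χ hχ hgχ using hg
  refine ⟨χ, hχ, ((Lp.tendsto_Lp_iff_tendsto_eLpNorm g f (hf.restrict U)).1 hlim).congr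
    fun n => ?_⟩
  have hindicator : U.indicator (χ n - f) = χ n - f := Set.indicator_eq_self.2 fun x hx => by
    by_contra hxU
    exact hx (by simp [(hχ n).eq_zero_of_notMem hxU, hfU x hxU])
  rw [eLpNorm_congr_ae ((hgχ n).sub .rfl),
    ← eLpNorm_indicator_eq_eLpNorm_restrict hU.measurableSet, hindicator]

end TestFunctions

section Energy

variable {V : Type*} [NormedAddCommGroup V]

theorem ofReal_norm_mul_enorm_sq (k : V) (z : ℂ) :
    ENNReal.ofReal ‖k‖ * ‖z‖ₑ ^ 2 = ‖(Real.sqrt ‖k‖ : ℂ) * z‖ₑ ^ 2 := by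
  rw [enorm_mul, mul_pow, ← ofReal_norm (Real.sqrt ‖k‖ : ℂ), Complex.norm_real, Real.norm_eq_abs,
    ← ENNReal.ofReal_pow (abs_nonneg _), sq_abs, Real.sq_sqrt (norm_nonneg k)]

variable [MeasurableSpace V] {ν : Measure V} {U : Set V}

theorem eLpNorm_sqrt_norm_mul_le {C : ℝ} (hC : ∀ k ∈ U, ‖k‖ ≤ C) {f : V → ℂ}
    (hfU : ∀ k ∉ U, f k = 0) :
    eLpNorm (fun k => (Real.sqrt ‖k‖ : ℂ) * f k) 2 ν ≤
      ENNReal.ofReal (Real.sqrt C) * eLpNorm f 2 ν := by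
  refine eLpNorm_le_mul_eLpNorm_of_ae_le_mul (Eventually.of_forall fun k => ?_) 2
  by_cases hk : k ∈ U
  · rw [norm_mul, Complex.norm_real, Real.norm_of_nonneg (Real.sqrt_nonneg _)]
    gcongr
    exact hC k hk
  · simp [hfU k hk]

theorem tendsto_eLpNorm_two {α ι : Type*} [MeasurableSpace α] {ν : Measure α} {L : Filter ι}
    {f : ι → α → ℂ} {g : α → ℂ} (hf : ∀ i, MemLp (f i) 2 ν) (hg : MemLp g 2 ν)
    (hlim : Tendsto (fun i => eLpNorm (f i - g) 2 ν) L (𝓝 0)) :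
    Tendsto (fun i => eLpNorm (f i) 2 ν) L (𝓝 (eLpNorm g 2 ν)) := by
  simpa only [Lp.enorm_toLp] using ((Lp.tendsto_Lp_iff_tendsto_eLpNorm'' f hf g hg).2 hlim).enorm

variable [BorelSpace V]

theorem tendsto_lintegral_norm_mul_sq (hU : Bornology.IsBounded U) {χ : ℕ → V → ℂ} {ψ : V → ℂ}
    (hχ : ∀ n, MemLp (χ n) 2 ν) (hψ : MemLp ψ 2 ν) (hχU : ∀ n, ∀ k ∉ U, χ n k = 0)
    (hψU : ∀ k ∉ U, ψ k = 0) (hlim : Tendsto (fun n => eLpNorm (χ n - ψ) 2 ν) atTop (𝓝 0)) :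
    Tendsto (fun n => ∫⁻ k, ENNReal.ofReal ‖k‖ * ‖χ n k‖ₑ ^ 2 ∂ν) atTop
      (𝓝 (∫⁻ k, ENNReal.ofReal ‖k‖ * ‖ψ k‖ₑ ^ 2 ∂ν)) := by
  obtain ⟨C, hC⟩ := hU.exists_norm_le
  have hmemLp {f : V → ℂ} (hf : MemLp f 2 ν) (hfU : ∀ k ∉ U, f k = 0) :
      MemLp (fun k => (Real.sqrt ‖k‖ : ℂ) * f k) 2 ν :=
    ⟨(by fun_prop : Continuous fun k : V => (Real.sqrt ‖k‖ : ℂ)).aestronglyMeasurable.mul hf.1,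
      (eLpNorm_sqrt_norm_mul_le hC hfU).trans_lt (ENNReal.mul_lt_top ENNReal.ofReal_lt_top hf.2)⟩
  simp_rw [ofReal_norm_mul_enorm_sq, ← eLpNorm_two_sq]
  refine ENNReal.Tendsto.pow (tendsto_eLpNorm_two (fun n => hmemLp (hχ n) (hχU n))
    (hmemLp hψ hψU) ?_)
  refine tendsto_of_tendsto_of_tendsto_of_le_of_le tendsto_const_nhds
    (h := fun n => ENNReal.ofReal (Real.sqrt C) * eLpNorm (χ n - ψ) 2 ν) ?_
    (fun _ => zero_le) fun n => ?_
  · simpa using ENNReal.Tendsto.const_mul hlim (Or.inr ENNReal.ofReal_ne_top)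
  · refine le_of_eq_of_le (congrArg (eLpNorm · 2 ν) ?_)
      (eLpNorm_sqrt_norm_mul_le hC (f := χ n - ψ) fun k hk => ?_)
    · funext k
      simp [mul_sub]
    · simp [hχU n k hk, hψU k hk]

end Energy

section OnePhoton

variable {V ι Y J : Type*} [MeasureSpace V] [Fintype ι]

/-- The bilinear pairing `∑_λ ∫ g_λ(k) ψ_λ(k) dk` of one-photon functions. -/
def pairing (g ψ : ι → V → ℂ) : ℂ := ∑ l, ∫ k, g l k * ψ l k

theorem tendsto_pairing {g ψ : ι → V → ℂ} {χ : ℕ → ι → V → ℂ} (hg : ∀ l, MemLp (g l) 2)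
    (hψ : ∀ l, MemLp (ψ l) 2) (hχ : ∀ n l, MemLp (χ n l) 2)
    (hlim : ∀ l, Tendsto (fun n => eLpNorm (χ n l - ψ l) 2) atTop (𝓝 0)) :
    Tendsto (fun n => pairing g (χ n)) atTop (𝓝 (pairing g ψ)) :=
  tendsto_finsetSum _ fun l _ =>
    tendsto_integral_mul_of_tendsto_eLpNorm (hg l) (hψ l) (fun n => hχ n l) (hlim l)

theorem pairing_indicator {g : ι → V → ℂ} {U : Set V} (hgU : ∀ l, ∀ k ∉ U, g l k = 0)
    (ψ : ι → V → ℂ) : pairing g (fun l => U.indicator (ψ l)) = pairing g ψ := by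
  refine Finset.sum_congr rfl fun l _ => integral_congr_ae (Eventually.of_forall fun k => ?_)
  by_cases hk : k ∈ U
  · simp [hk]
  · simp [hgU l k hk]

variable [MeasurableSpace Y]

/-- Square integrable one-photon functions `g y` that depend measurably on the parameter `y`, on
which the measure `ρ` is given. -/
structure IsSmearingFamily (ρ : Measure Y) (g : Y → ι → V → ℂ) : Prop where
  measurable : ∀ l, AEStronglyMeasurable (fun q : Y × V => g q.1 l q.2) (ρ.prod volume)
  memLp : ∀ y l, MemLp (g y l) 2

theorem IsSmearingFamily.aestronglyMeasurable_pairing [SFinite (volume : Measure V)]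
    {ρ : Measure Y} {g : Y → ι → V → ℂ} (hg : IsSmearingFamily ρ g) {ψ : ι → V → ℂ}
    (hψ : ∀ l, AEStronglyMeasurable (ψ l) volume) :
    AEStronglyMeasurable (fun y => pairing (g y) ψ) ρ :=
  Finset.aestronglyMeasurable_fun_sum _ fun l _ =>
    ((hg.measurable l).mul (hψ l).comp_snd).integral_prod_right'

variable [NormedAddCommGroup V]

/-- The form `∑_λ ∫ |k| |ψ_λ(k)|² dk` of the energy of a single photon. -/
def photonEnergy (ψ : ι → V → ℂ) : ℝ≥0∞ :=
  ∑ l, ∫⁻ k, ENNReal.ofReal ‖k‖ * ‖ψ l k‖ₑ ^ 2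

theorem photonEnergy_indicator_le (U : Set V) (ψ : ι → V → ℂ) :
    photonEnergy (fun l => U.indicator (ψ l)) ≤ photonEnergy ψ := by
  refine Finset.sum_le_sum fun l _ => lintegral_mono fun k => ?_
  gcongr
  exact enorm_indicator_le_enorm_self _ _

/-- The one-photon operators `∑_j ∫ |g_j(y)⟩⟨g_j(y)| dρ(y)` (up to complex conjugation) are bounded
by the energy of a photon, as quadratic forms. -/
def IsEnergyBounded (ρ : Measure Y) (g : J → Y → ι → V → ℂ) : Prop :=
  ∀ ψ : ι → V → ℂ, (∀ l, MemLp (ψ l) 2) →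
    ∑' j, ∫⁻ y, ‖pairing (g j y) ψ‖ₑ ^ 2 ∂ρ ≤ photonEnergy ψ

theorem IsEnergyBounded.mono {ρ ρ' : Measure Y} {g : J → Y → ι → V → ℂ}
    (h : IsEnergyBounded ρ' g) (hρ : ρ ≤ ρ') : IsEnergyBounded ρ g := fun ψ hψ =>
  (ENNReal.tsum_le_tsum fun _ => lintegral_mono' hρ le_rfl).trans (h ψ hψ)

end OnePhoton

section Closure

variable {V ι Y J : Type*} [NormedAddCommGroup V] [NormedSpace ℝ V] [FiniteDimensional ℝ V]
  [MeasureSpace V] [BorelSpace V] [IsLocallyFiniteMeasure (volume : Measure V)] [Fintype ι]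
  [MeasurableSpace Y]

theorem isEnergyBounded_of_isTestFunction {ρ : Measure Y} {U : Set V} (hU : IsOpen U)
    (hUb : Bornology.IsBounded U) {g : J → Y → ι → V → ℂ} (hg : ∀ j, IsSmearingFamily ρ (g j))
    (hgU : ∀ j y l, ∀ k ∉ U, g j y l k = 0)
    (htest : ∀ χ : ι → V → ℂ, (∀ l, IsTestFunction U (χ l)) →
      ∑' j, ∫⁻ y, ‖pairing (g j y) χ‖ₑ ^ 2 ∂ρ ≤ photonEnergy χ) :
    IsEnergyBounded ρ g := by
  intro ψ hψ
  have hψU (l : ι) : MemLp (U.indicator (ψ l)) 2 := (hψ l).indicator hU.measurableSet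
  have hzero (l : ι) : ∀ k ∉ U, U.indicator (ψ l) k = 0 := fun k hk =>
    Set.indicator_of_notMem hk _
  choose χ hχ hlim using fun l => exists_testFunction_tendsto volume hU (hψU l) (hzero l)
  have hχL (l : ι) (n : ℕ) := (hχ l n).memLp (volume : Measure V)
  simp_rw [← fun j y => pairing_indicator (hgU j y) ψ]
  refine (tsum_lintegral_le_of_tendsto
    (F := fun n j y => ‖pairing (g j y) fun l => χ l n‖ₑ ^ 2)
    (R := fun n => photonEnergy fun l => χ l n)
    (r := photonEnergy fun l => U.indicator (ψ l)) (fun n j => ?_) (fun j y => ?_)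
    (fun n => htest _ fun l => hχ l n) ?_).trans (photonEnergy_indicator_le U ψ)
  · exact ((hg j).aestronglyMeasurable_pairing fun l => (hχL l n).1).enorm.pow_const 2
  · exact ENNReal.Tendsto.pow
      (tendsto_pairing ((hg j).memLp y) hψU (fun n l => hχL l n) hlim).enorm
  · exact tendsto_finsetSum _ fun l _ => tendsto_lintegral_norm_mul_sq hUb (hχL l) (hψU l)
      (fun n k hk => (hχ l n).eq_zero_of_notMem hk) (hzero l) (hlim l)

end Closure

section PlaneWaveFamilies

variable {V ι : Type*} [NormedAddCommGroup V] [InnerProductSpace ℝ V] [FiniteDimensional ℝ V]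
  [MeasurableSpace V] [BorelSpace V]

theorem isSmearingFamily_mul_planeWave {ρ : Measure V} {G : ι → V → ℂ}
    (hG : ∀ l, MemLp (G l) 2) : IsSmearingFamily ρ fun y l k => G l k * planeWave y k where
  measurable l := (hG l).1.comp_snd.mul continuous_planeWave_uncurry.aestronglyMeasurable
  memLp y l := (hG l).congr_enorm ((hG l).1.mul (continuous_planeWave y).aestronglyMeasurable)
    (Eventually.of_forall fun k => by rw [enorm_mul, enorm_planeWave, mul_one])

end PlaneWaveFamilies

section FourierTransforms

open scoped ContDiff

theorem IsFourierTransformOf.locallyIntegrable {vhat : R3 → ℂ} {v : 𝓢'(R3, ℂ)}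
    (hv : IsFourierTransformOf vhat v) : LocallyIntegrable vhat := by
  intro x
  let f : ContDiffBump x := ⟨1, 2, one_pos, one_lt_two⟩
  have hcompact : HasCompactSupport (Complex.ofRealCLM ∘ f) := f.hasCompactSupport.comp_left rfl
  have hsmooth : ContDiff ℝ ∞ (Complex.ofRealCLM ∘ f) :=
    Complex.ofRealCLM.contDiff.comp f.contDiff
  refine ⟨Metric.ball x 1, Metric.ball_mem_nhds x one_pos,
    ((hv (hcompact.toSchwartzMap hsmooth)).1.integrableOn).congr_fun (fun k hk => ?_)
      measurableSet_ball⟩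
  simp [f.one_of_mem_closedBall (Metric.ball_subset_closedBall hk)]

/-- The inverse of `schwartzFourier`; see `schwartzFourierInv_apply`. -/
def schwartzFourierInv (φ : 𝓢(R3, ℂ)) : 𝓢(R3, ℂ) :=
  compCLMOfContinuousLinearEquiv ℂ (ContinuousLinearEquiv.neg ℝ (M := R3)) (schwartzFourier φ)

theorem schwartzFourierInv_apply (φ : 𝓢(R3, ℂ)) (z : R3) :
    schwartzFourierInv φ z =
      (((2 * Real.pi) ^ (-(3 / 2) : ℝ) : ℝ) : ℂ) * ∫ k : R3, φ k * planeWave z k := by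
  change schwartzFourier φ (-z) = _
  simp [schwartzFourier_apply, planeWave]

theorem lintegral_schwartzFourierInv_sq (φ : 𝓢(R3, ℂ)) :
    ∫⁻ z, ‖schwartzFourierInv φ z‖ₑ ^ 2 = ∫⁻ k, ‖φ k‖ₑ ^ 2 := by
  have hpi := Real.two_pi_pos
  simp_rw [schwartzFourierInv_apply, enorm_mul, mul_pow]
  rw [lintegral_const_mul' _ _ (by finiteness),
    lintegral_planeWave_sq φ.integrable (φ.memLp 2), finrank_euclideanSpace_fin, ← mul_assoc,
    ← ofReal_norm, Complex.norm_real, Real.norm_of_nonneg (by positivity),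
    ← ENNReal.ofReal_pow (by positivity), ← ENNReal.ofReal_mul (by positivity),
    ← Real.rpow_natCast, ← Real.rpow_natCast, ← Real.rpow_mul hpi.le, ← Real.rpow_add hpi]
  norm_num

theorem reflectTranslate_schwartzFourierInv {F : R3 → ℂ} (hF : HasCompactSupport F)
    (hFs : ContDiff ℝ ∞ F) (y : R3) :
    reflectTranslate (schwartzFourierInv (hF.toSchwartzMap hFs)) y =
      schwartzFourier ((hF.mul_right (f' := planeWave y)).toSchwartzMap
        (hFs.mul (contDiff_planeWave y))) := by
  ext z
  rw [reflectTranslate_apply, schwartzFourierInv_apply, schwartzFourier_apply]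
  congr 1
  refine integral_congr_ae (Eventually.of_forall fun k => ?_)
  simp only [HasCompactSupport.toSchwartzMap_toFun, inner_sub_right, planeWave, Pi.mul_apply]
  rw [mul_assoc, ← Complex.exp_add]
  congr 2
  push_cast
  ring

theorem conv_schwartzFourierInv {vhat : R3 → ℂ} {v : 𝓢'(R3, ℂ)} (hv : IsFourierTransformOf vhat v)
    {F : R3 → ℂ} (hF : HasCompactSupport F) (hFs : ContDiff ℝ ∞ F) (y : R3) :
    conv (schwartzFourierInv (hF.toSchwartzMap hFs)) v y =
      ∫ k, vhat k * (F k * planeWave y k) := by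
  rw [conv, reflectTranslate_schwartzFourierInv, (hv _).2]
  rfl

theorem le_of_weightNorm_le_one {J : Set ℤ} {v : Fin 2 → J → 𝓢'(R3, ℂ)} {w : R3 → ℝ}
    (h : weightNorm v w ≤ 1) (f : Fin 2 → 𝓢(R3, ℂ)) :
    ∑' j : J, ∫⁻ x, ‖∑ l, conv (f l) (v l j) x‖ₑ ^ 2 * ‖w x‖ₑ ≤ ∑ l, ∫⁻ x, ‖f l x‖ₑ ^ 2 := by
  have hquotient := (le_iSup (fun f : Fin 2 → 𝓢(R3, ℂ) =>
    (∑' j : J, ∫⁻ x, ‖∑ l, conv (f l) (v l j) x‖ₑ ^ 2 * ‖w x‖ₑ) /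
      (∑ l, ∫⁻ x, ‖f l x‖ₑ ^ 2)) f).trans h
  simpa using (ENNReal.div_le_iff_le_mul (by simp) (by simp)).1 hquotient

theorem contDiff_sqrt_norm_mul {V : Type*} [NormedAddCommGroup V] [InnerProductSpace ℝ V]
    {U : Set V} (h0 : (0 : V) ∉ U) {χ : V → ℂ} (hχ : IsTestFunction U χ) :
    ContDiff ℝ ∞ fun k => (Real.sqrt ‖k‖ : ℂ) * χ k := by
  refine contDiff_iff_contDiffAt.2 fun k => ?_
  rcases eq_or_ne k 0 with rfl | hk
  · have hzero : (fun k => (Real.sqrt ‖k‖ : ℂ) * χ k) =ᶠ[𝓝 0] fun _ => 0 := by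
      filter_upwards [notMem_tsupport_iff_eventuallyEq.1 fun h => h0 (hχ.tsupport_subset h)]
        with z hz
      simp [hz]
    exact contDiffAt_const.congr_of_eventuallyEq hzero
  · have hsqrt : ContDiffAt ℝ ∞ (fun k : V => Real.sqrt ‖k‖) k :=
      (contDiffAt_norm ℝ hk).sqrt (norm_ne_zero_iff.2 hk)
    exact (Complex.ofRealCLM.contDiff.contDiffAt.comp k hsqrt).mul hχ.contDiff.contDiffAt

end FourierTransforms

section ModeFunction

variable {Λ : ℝ}

theorem modeFunction_eq (vhat : Fin 2 → R3 → ℂ) (y : R3) (l : Fin 2) (k : R3) :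
    modeFunction Λ vhat y l k = modeFunction Λ vhat 0 l k * planeWave y k := by
  by_cases hk : k ∈ Metric.ball (0 : R3) Λ <;> simp [modeFunction, planeWave, hk]

theorem modeFunction_eq_zero (vhat : Fin 2 → R3 → ℂ) (y : R3) (l : Fin 2) {k : R3}
    (hk : k ∉ Metric.ball (0 : R3) Λ \ {0}) : modeFunction Λ vhat y l k = 0 := by
  rcases eq_or_ne k 0 with rfl | hk0
  · simp [modeFunction]
  · exact Set.indicator_of_notMem (fun h => hk ⟨h, hk0⟩) _

theorem lintegral_modeFunction_sq (vhat : Fin 2 → R3 → ℂ) (y : R3) (l : Fin 2) :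
    ∫⁻ k, ‖modeFunction Λ vhat y l k‖ₑ ^ 2 =
      ∫⁻ k in Metric.ball (0 : R3) Λ, ENNReal.ofReal ‖k‖ * ‖vhat l k‖ₑ ^ 2 := by
  rw [← lintegral_indicator measurableSet_ball]
  refine lintegral_congr fun k => ?_
  rw [modeFunction_eq, enorm_mul, enorm_planeWave, mul_one]
  simp_rw [ofReal_norm_mul_enorm_sq]
  by_cases hk : k ∈ Metric.ball (0 : R3) Λ
  · simp only [modeFunction, hk, Set.indicator_of_mem, inner_zero_right, Complex.ofReal_zero,
      mul_zero, Complex.exp_zero, mul_one]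
  · simp [modeFunction, hk]

theorem memLp_modeFunction {vhat : Fin 2 → R3 → ℂ} {l : Fin 2}
    (hmeas : AEStronglyMeasurable (vhat l) volume)
    (hfin : ∫⁻ k in Metric.ball (0 : R3) Λ, ENNReal.ofReal ‖k‖ * ‖vhat l k‖ₑ ^ 2 < ∞) (y : R3) :
    MemLp (modeFunction Λ vhat y l) 2 := by
  refine memLp_two_iff_lintegral.2 ⟨?_, by rwa [lintegral_modeFunction_sq]⟩
  have hsqrt : Continuous fun k : R3 => (Real.sqrt ‖k‖ : ℂ) := by fun_prop
  exact ((hsqrt.aestronglyMeasurable.mul hmeas).mul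
    (continuous_planeWave y).aestronglyMeasurable).indicator measurableSet_ball

theorem isSmearingFamily_modeFunction {ρ : Measure R3} {vhat : Fin 2 → R3 → ℂ}
    (hG : ∀ l, MemLp (modeFunction Λ vhat 0 l) 2) : IsSmearingFamily ρ (modeFunction Λ vhat) := by
  have hfun : modeFunction Λ vhat = fun y l k => modeFunction Λ vhat 0 l k * planeWave y k :=
    funext fun y => funext fun l => funext (modeFunction_eq vhat y l)
  exact hfun ▸ isSmearingFamily_mul_planeWave hG

open scoped ContDiff in
theorem pairing_modeFunction_eq_sum_conv {vhat : Fin 2 → R3 → ℂ} {v : Fin 2 → 𝓢'(R3, ℂ)}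
    (hv : ∀ l, IsFourierTransformOf (vhat l) (v l)) {χ : Fin 2 → R3 → ℂ}
    (hχ : ∀ l, ∀ k ∉ Metric.ball (0 : R3) Λ, χ l k = 0)
    (hF : ∀ l, HasCompactSupport fun k => (Real.sqrt ‖k‖ : ℂ) * χ l k)
    (hFs : ∀ l, ContDiff ℝ ∞ fun k => (Real.sqrt ‖k‖ : ℂ) * χ l k) (y : R3) :
    pairing (modeFunction Λ vhat y) χ =
      ∑ l, conv (schwartzFourierInv ((hF l).toSchwartzMap (hFs l))) (v l) y := by
  refine Finset.sum_congr rfl fun l _ => ?_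
  rw [conv_schwartzFourierInv (hv l)]
  refine integral_congr_ae (Eventually.of_forall fun k => ?_)
  by_cases hk : k ∈ Metric.ball (0 : R3) Λ
  · simp only [modeFunction, hk, Set.indicator_of_mem, planeWave]
    ring
  · simp [hχ l k hk]

theorem isEnergyBounded_modeFunction {J : Set ℤ} {v : Fin 2 → J → 𝓢'(R3, ℂ)}
    {vhat : Fin 2 → J → R3 → ℂ} {w : R3 → ℝ} (hv : ∀ l j, IsFourierTransformOf (vhat l j) (v l j))
    (hG : ∀ j l, MemLp (modeFunction Λ (fun l => vhat l j) 0 l) 2)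
    (hw : AEStronglyMeasurable w volume) (h : weightNorm v w ≤ 1) :
    IsEnergyBounded (volume.withDensity fun y => ‖w y‖ₑ)
      fun j => modeFunction Λ fun l => vhat l j := by
  have hopen : IsOpen (Metric.ball (0 : R3) Λ \ {0}) :=
    Metric.isOpen_ball.sdiff isClosed_singleton
  refine isEnergyBounded_of_isTestFunction hopen (Metric.isBounded_ball.subset Set.sdiff_subset)
    (fun j => isSmearingFamily_modeFunction (hG j))
    (fun j y l k hk => modeFunction_eq_zero _ y l hk)
    fun χ hχ => ?_
  have hF (l : Fin 2) : HasCompactSupport fun k => (Real.sqrt ‖k‖ : ℂ) * χ l k :=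
    (hχ l).compact.mul_left
  have hFs (l : Fin 2) := contDiff_sqrt_norm_mul (fun h => h.2 rfl) (hχ l)
  have hzero (l : Fin 2) : ∀ k ∉ Metric.ball (0 : R3) Λ, χ l k = 0 := fun k hk =>
    (hχ l).eq_zero_of_notMem fun h => hk h.1
  have hconv := le_of_weightNorm_le_one h fun l =>
    schwartzFourierInv ((hF l).toSchwartzMap (hFs l))
  simp_rw [lintegral_schwartzFourierInv_sq, HasCompactSupport.toSchwartzMap_toFun,
    ← ofReal_norm_mul_enorm_sq] at hconv
  simp_rw [lintegral_withDensity_enorm hw,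
    pairing_modeFunction_eq_sum_conv (fun l => hv l _) hzero hF hFs, mul_comm ‖w _‖ₑ]
  exact hconv

end ModeFunction

section Modes

instance : SigmaFinite modeMeasure := inferInstanceAs (SigmaFinite (volume.prod Measure.count))

theorem lintegral_modeMeasure {f : Mode → ℝ≥0∞} (hf : AEMeasurable f modeMeasure) :
    ∫⁻ p, f p ∂modeMeasure = ∑ l, ∫⁻ k, f (k, l) := by
  rw [modeMeasure, lintegral_prod_symm f hf, lintegral_count, tsum_fintype]

theorem integral_modeMeasure {f : Mode → ℂ} (hf : Integrable f modeMeasure) :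
    ∫ p, f p ∂modeMeasure = ∑ l, ∫ k, f (k, l) := by
  rw [modeMeasure, integral_prod_symm f hf, integral_fintype Integrable.of_finite]
  simp [Measure.real]

theorem quasiMeasurePreserving_prodMk_polarization (l : Fin 2) :
    Measure.QuasiMeasurePreserving (fun k : R3 => ((k, l) : Mode)) volume modeMeasure := by
  refine ⟨by fun_prop, Measure.AbsolutelyContinuous.mk fun s hs h0 => ?_⟩
  rw [modeMeasure, Measure.prod_apply_symm hs, lintegral_count, tsum_fintype] at h0
  rw [Measure.map_apply (by fun_prop) hs]
  exact (Finset.sum_eq_zero_iff.1 h0) l (Finset.mem_univ l)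

theorem memLp_polarization {ψ : Mode → ℂ} (hψ : MemLp ψ 2 modeMeasure) (l : Fin 2) :
    MemLp (fun k => ψ (k, l)) 2 := by
  have h := memLp_two_iff_lintegral.1 hψ
  refine memLp_two_iff_lintegral.2
    ⟨h.1.comp_quasiMeasurePreserving (quasiMeasurePreserving_prodMk_polarization l), ?_⟩
  rw [lintegral_modeMeasure (h.1.enorm.pow_const 2)] at h
  exact ENNReal.sum_lt_top.1 h.2 l (Finset.mem_univ l)

/-- A one-photon amplitude with components `G_λ(k)`, as a function of the mode `(k, λ)`. -/
def onModes (G : Fin 2 → R3 → ℂ) (p : Mode) : ℂ := G p.2 p.1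

variable {G : Fin 2 → R3 → ℂ}

theorem aestronglyMeasurable_onModes (hG : ∀ l, AEStronglyMeasurable (G l)) :
    AEStronglyMeasurable (onModes G) modeMeasure := by
  have hsum : onModes G =
      fun p => ∑ l, (Prod.snd ⁻¹' {l}).indicator (fun p : Mode => G l p.1) p := by
    funext p
    rw [Finset.sum_eq_single p.2 (fun l _ hl => Set.indicator_of_notMem (by simpa using hl.symm) _)
      (by simp), Set.indicator_of_mem (by simp), onModes]
  rw [hsum]
  exact Finset.aestronglyMeasurable_fun_sum _ fun l _ =>
    (hG l).comp_fst.indicator (measurable_snd (measurableSet_singleton l))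

theorem lintegral_onModes_sq (hG : ∀ l, AEStronglyMeasurable (G l)) :
    ∫⁻ p, ‖onModes G p‖ₑ ^ 2 ∂modeMeasure = ∑ l, ∫⁻ k, ‖G l k‖ₑ ^ 2 :=
  lintegral_modeMeasure ((aestronglyMeasurable_onModes hG).enorm.pow_const 2)

theorem memLp_onModes (hG : ∀ l, MemLp (G l) 2) : MemLp (onModes G) 2 modeMeasure := by
  rw [memLp_two_iff_lintegral, lintegral_onModes_sq fun l => (hG l).1]
  exact ⟨aestronglyMeasurable_onModes fun l => (hG l).1,
    ENNReal.sum_lt_top.2 fun l _ => (memLp_two_iff_lintegral.1 (hG l)).2⟩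

end Modes

section Fock

instance (n : ℕ) : SigmaFinite (photonMeasure n) :=
  inferInstanceAs (SigmaFinite (configMeasure modeMeasure n))

/-- The component `(l, k) ↦ Ψ_{n+1}(x_1, …, x_n, (k, l))` of `Ψ` as a function of its last photon,
which is the photon that `annihilate` removes. -/
def lastPhoton (Ψ : FockSeq) (n : ℕ) (x : Fin n → Mode) (l : Fin 2) (k : R3) : ℂ :=
  Ψ (n + 1) (addParticle x (k, l))

variable {Ψ : FockSeq} {G : Fin 2 → R3 → ℂ}

theorem annihilate_eq (G : Fin 2 → R3 → ℂ) (Ψ : FockSeq) (n : ℕ) (x : Fin n → Mode) :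
    annihilate G Ψ n x = (Real.sqrt (n + 1) : ℂ) * pairing G (lastPhoton Ψ n x) :=
  rfl

theorem create_succ (G : Fin 2 → R3 → ℂ) (Ψ : FockSeq) (n : ℕ) (x : Fin (n + 1) → Mode) :
    create G Ψ (n + 1) x =
      ((Real.sqrt (n + 1))⁻¹ : ℂ) * ∑ i, tensorTerm (onModes G) (Ψ n) i x :=
  rfl

theorem enorm_sqrt_succ_sq (n : ℕ) : ‖(Real.sqrt (n + 1) : ℂ)‖ₑ ^ 2 = n + 1 := by
  rw [← ofReal_norm, Complex.norm_real, ← ENNReal.ofReal_pow (norm_nonneg _), Real.norm_eq_abs,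
    sq_abs, Real.sq_sqrt (by positivity)]
  exact_mod_cast ENNReal.ofReal_natCast (n + 1)

theorem normSq_annihilate (G : Fin 2 → R3 → ℂ) (Ψ : FockSeq) :
    normSq (annihilate G Ψ) =
      ∑' n : ℕ, ((n : ℝ≥0∞) + 1) * ∫⁻ x, ‖pairing G (lastPhoton Ψ n x)‖ₑ ^ 2 ∂photonMeasure n := by
  refine tsum_congr fun n => ?_
  rw [← lintegral_const_mul' _ _ (by finiteness)]
  simp_rw [annihilate_eq, enorm_mul, mul_pow, enorm_sqrt_succ_sq]

namespace IsFockVector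

theorem memLp (hΨ : IsFockVector Ψ) (n : ℕ) : MemLp (Ψ n) 2 (configMeasure modeMeasure n) :=
  memLp_two_iff_lintegral.2
    ⟨hΨ.measurable n, (ENNReal.le_tsum n).trans_lt hΨ.normSq_lt_top⟩

theorem ae_memLp_addParticle (hΨ : IsFockVector Ψ) (n : ℕ) :
    ∀ᵐ x ∂configMeasure modeMeasure n,
      MemLp (fun p => Ψ (n + 1) (addParticle x p)) 2 modeMeasure := by
  have h := memLp_two_iff_lintegral.1 (hΨ.memLp (n + 1))
  have hmeas := h.1.comp_measurePreserving (measurePreserving_addParticle modeMeasure n)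
  have hfin := h.2
  rw [lintegral_addParticle (h.1.enorm.pow_const 2)] at hfin
  filter_upwards [hmeas.prodMk_left,
    ae_lt_top' (hmeas.enorm.pow_const 2).lintegral_prod_right' hfin.ne] with x hxmeas hxfin
  exact memLp_two_iff_lintegral.2 ⟨hxmeas, hxfin⟩

theorem ae_memLp_lastPhoton (hΨ : IsFockVector Ψ) (n : ℕ) :
    ∀ᵐ x ∂configMeasure modeMeasure n, ∀ l, MemLp (lastPhoton Ψ n x l) 2 :=
  (hΨ.ae_memLp_addParticle n).mono fun _ hx => memLp_polarization hx

theorem pairing_lastPhoton_ae_eq (hΨ : IsFockVector Ψ) (hG : ∀ l, MemLp (G l) 2) (n : ℕ) :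
    (fun x => pairing G (lastPhoton Ψ n x)) =ᵐ[configMeasure modeMeasure n]
      contract modeMeasure (onModes G) (Ψ (n + 1)) :=
  (hΨ.ae_memLp_addParticle n).mono fun _ hx =>
    (integral_modeMeasure ((memLp_onModes hG).integrable_mul hx)).symm

theorem lintegral_create_one_sq (hΨ : IsFockVector Ψ) (hG : ∀ l, MemLp (G l) 2) :
    ∫⁻ x, ‖create G Ψ 1 x‖ₑ ^ 2 ∂photonMeasure 1 =
      (∑ l, ∫⁻ k, ‖G l k‖ₑ ^ 2) * ∫⁻ x, ‖Ψ 0 x‖ₑ ^ 2 ∂photonMeasure 0 := by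
  rw [← lintegral_onModes_sq fun l => (hG l).1]
  refine (lintegral_congr fun x => ?_).trans
    (lintegral_tensorTerm_sq (memLp_onModes hG).1 (hΨ.measurable 0) 0)
  simp [create_succ]

theorem lintegral_create_add_two_sq (hΨ : IsFockVector Ψ) (hG : ∀ l, MemLp (G l) 2) (n : ℕ) :
    ∫⁻ x, ‖create G Ψ (n + 2) x‖ₑ ^ 2 ∂photonMeasure (n + 2) =
      (∑ l, ∫⁻ k, ‖G l k‖ₑ ^ 2) * ∫⁻ x, ‖Ψ (n + 1) x‖ₑ ^ 2 ∂photonMeasure (n + 1) +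
      (n + 1) * ∫⁻ x, ‖pairing (fun l k => conj (G l k)) (lastPhoton Ψ n x)‖ₑ ^ 2
        ∂photonMeasure n := by
  have hcreate (x : Fin (n + 2) → Mode) : ‖create G Ψ (n + 2) x‖ₑ ^ 2 =
      ((n : ℝ≥0∞) + 2)⁻¹ * ‖∑ i, tensorTerm (onModes G) (Ψ (n + 1)) i x‖ₑ ^ 2 := by
    rw [create_succ, enorm_mul, mul_pow, enorm_inv (Complex.ofReal_ne_zero.2 (by positivity)),
      ← ENNReal.inv_pow, enorm_sqrt_succ_sq]
    push_cast
    rw [add_assoc, one_add_one_eq_two]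
  have hcontract : ∫⁻ x, ‖pairing (fun l k => conj (G l k)) (lastPhoton Ψ n x)‖ₑ ^ 2
      ∂photonMeasure n = ∫⁻ x, ‖contract modeMeasure (fun p => conj (onModes G p))
        (Ψ (n + 1)) x‖ₑ ^ 2 ∂configMeasure modeMeasure n :=
    lintegral_congr_ae ((hΨ.pairing_lastPhoton_ae_eq (fun l => memLp_conj (hG l)) n).mono
      fun _ hx => congrArg (‖·‖ₑ ^ 2) hx)
  simp_rw [hcreate, hcontract, ← lintegral_onModes_sq fun l => (hG l).1]
  rw [lintegral_const_mul' _ _ (by simp)]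
  exact (congrArg _ (lintegral_sum_tensorTerm_sq (memLp_onModes hG) (hΨ.memLp (n + 1))
    (hΨ.symmetric (n + 1)))).trans (ENNReal.inv_mul_cancel_left (by simp) (by finiteness))

/-- The commutation relation `a(Ḡ) a*(G) = a*(G) a(Ḡ) + ‖G‖²`, as an identity of forms. -/
theorem normSq_create (hΨ : IsFockVector Ψ) (hG : ∀ l, MemLp (G l) 2) :
    normSq (create G Ψ) = (∑ l, ∫⁻ k, ‖G l k‖ₑ ^ 2) * normSq Ψ +
      normSq (annihilate (fun l k => conj (G l k)) Ψ) := by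
  have hzero : ∫⁻ x, ‖create G Ψ 0 x‖ₑ ^ 2 ∂photonMeasure 0 = 0 := by simp [create]
  have hsplit : normSq Ψ = ∫⁻ x, ‖Ψ 0 x‖ₑ ^ 2 ∂photonMeasure 0 +
      ∑' n, ∫⁻ x, ‖Ψ (n + 1) x‖ₑ ^ 2 ∂photonMeasure (n + 1) :=
    tsum_eq_zero_add' ENNReal.summable
  rw [hsplit, normSq, tsum_eq_zero_add' ENNReal.summable, hzero, zero_add,
    tsum_eq_zero_add' ENNReal.summable, zero_add, hΨ.lintegral_create_one_sq hG,
    tsum_congr (hΨ.lintegral_create_add_two_sq hG), ENNReal.tsum_add, ENNReal.tsum_mul_left,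
    normSq_annihilate, mul_add, add_assoc]

theorem fieldEnergy_eq (hΨ : IsFockVector Ψ) :
    fieldEnergy Ψ =
      ∑' n : ℕ, ((n : ℝ≥0∞) + 1) * ∫⁻ x, photonEnergy (lastPhoton Ψ n x) ∂photonMeasure n := by
  rw [fieldEnergy, tsum_eq_zero_add' ENNReal.summable]
  simp only [Finset.univ_eq_empty, Finset.sum_empty, ENNReal.ofReal_zero, zero_mul,
    lintegral_zero, zero_add]
  refine tsum_congr fun n => ?_
  have he : Measurable fun p : Mode => ENNReal.ofReal ‖p.1‖ := by fun_prop
  have hsymm : IsPermInvariant modeMeasure fun x => ‖Ψ (n + 1) x‖ₑ ^ 2 :=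
    IsPermInvariant.comp (hΨ.symmetric (n + 1)) fun z => ‖z‖ₑ ^ 2
  simp_rw [ENNReal.ofReal_sum_of_nonneg fun _ _ => norm_nonneg _]
  refine (lintegral_sum_mul_of_isPermInvariant he ((hΨ.measurable (n + 1)).enorm.pow_const 2)
    hsymm).trans (congrArg _ (lintegral_congr_ae ?_))
  filter_upwards [hΨ.ae_memLp_addParticle n] with x hx
  exact lintegral_modeMeasure (he.aemeasurable.mul (hx.1.enorm.pow_const 2))

end IsFockVector

end Fock

section SecondQuantization

variable {Y : Type*} [MeasurableSpace Y] {ρ : Measure Y} [SFinite ρ] {Ψ : FockSeq}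
  {g : Y → Fin 2 → R3 → ℂ}

theorem IsSmearingFamily.aestronglyMeasurable_pairing_lastPhoton (hg : IsSmearingFamily ρ g)
    (hΨ : IsFockVector Ψ) (n : ℕ) :
    AEStronglyMeasurable (fun q : Y × (Fin n → Mode) => pairing (g q.1) (lastPhoton Ψ n q.2))
      (ρ.prod (configMeasure modeMeasure n)) := by
  refine Finset.aestronglyMeasurable_fun_sum _ fun l _ =>
    AEStronglyMeasurable.integral_prod_right' (f := fun q : (Y × (Fin n → Mode)) × R3 =>
      g q.1.1 l q.2 * Ψ (n + 1) (addParticle q.1.2 (q.2, l))) (.mul ?_ ?_)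
  · exact (hg.measurable l).comp_quasiMeasurePreserving
      (QuasiMeasurePreserving.prodMap Measure.quasiMeasurePreserving_fst (.id volume))
  · have hadd := (measurePreserving_addParticle modeMeasure n).quasiMeasurePreserving.comp
      (QuasiMeasurePreserving.prodMap (.id _) (quasiMeasurePreserving_prodMk_polarization l))
    exact (hΨ.measurable (n + 1)).comp_quasiMeasurePreserving (hadd.comp
      (QuasiMeasurePreserving.prodMap Measure.quasiMeasurePreserving_snd (.id volume)))

theorem IsSmearingFamily.aemeasurable_lintegral_pairing_sq (hg : IsSmearingFamily ρ g)
    (hΨ : IsFockVector Ψ) (n : ℕ) :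
    AEMeasurable (fun y => ∫⁻ x, ‖pairing (g y) (lastPhoton Ψ n x)‖ₑ ^ 2 ∂photonMeasure n) ρ :=
  ((hg.aestronglyMeasurable_pairing_lastPhoton hΨ n).enorm.pow_const 2).lintegral_prod_right'

theorem IsSmearingFamily.aemeasurable_normSq_annihilate (hg : IsSmearingFamily ρ g)
    (hΨ : IsFockVector Ψ) : AEMeasurable (fun y => normSq (annihilate (g y) Ψ)) ρ := by
  simp_rw [normSq_annihilate]
  exact AEMeasurable.tsum fun n => (hg.aemeasurable_lintegral_pairing_sq hΨ n).const_mul _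

theorem lintegral_normSq_annihilate (hg : IsSmearingFamily ρ g) (hΨ : IsFockVector Ψ) :
    ∫⁻ y, normSq (annihilate (g y) Ψ) ∂ρ = ∑' n : ℕ, ((n : ℝ≥0∞) + 1) *
      ∫⁻ x, ∫⁻ y, ‖pairing (g y) (lastPhoton Ψ n x)‖ₑ ^ 2 ∂ρ ∂photonMeasure n := by
  simp_rw [normSq_annihilate]
  rw [lintegral_tsum fun n => (hg.aemeasurable_lintegral_pairing_sq hΨ n).const_mul _]
  refine tsum_congr fun n => ?_
  rw [lintegral_const_mul' _ _ (by finiteness)]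
  exact congrArg _ (lintegral_lintegral_swap
    ((hg.aestronglyMeasurable_pairing_lastPhoton hΨ n).enorm.pow_const 2))

theorem IsEnergyBounded.tsum_lintegral_normSq_annihilate_le {J : Type*}
    {g : J → Y → Fin 2 → R3 → ℂ} (hbound : IsEnergyBounded ρ g)
    (hg : ∀ j, IsSmearingFamily ρ (g j)) (hΨ : IsFockVector Ψ) :
    ∑' j, ∫⁻ y, normSq (annihilate (g j y) Ψ) ∂ρ ≤ fieldEnergy Ψ := by
  simp_rw [lintegral_normSq_annihilate (hg _) hΨ]
  rw [ENNReal.tsum_comm, hΨ.fieldEnergy_eq]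
  gcongr with n
  rw [ENNReal.tsum_mul_left]
  gcongr
  exact (tsum_lintegral_le_lintegral_tsum _).trans
    (lintegral_mono_ae ((hΨ.ae_memLp_lastPhoton n).mono fun x hx => hbound _ hx))

end SecondQuantization

section Quadratures

variable {Ψ : FockSeq} {c : ℂ}

/-- The field operator `a(g) + c a*(ḡ)`, where `a*(ḡ)` is the adjoint of `a(g)`. -/
def quadrature (g : Fin 2 → R3 → ℂ) (c : ℂ) (Ψ : FockSeq) : FockSeq :=
  annihilate g Ψ + c • create (fun l k => conj (g l k)) Ψ

theorem normSq_smul (c : ℂ) (X : FockSeq) : normSq (c • X) = ‖c‖ₑ ^ 2 * normSq X := by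
  rw [normSq, normSq, ← ENNReal.tsum_mul_left]
  refine tsum_congr fun n => ?_
  rw [← lintegral_const_mul' _ _ (by finiteness)]
  refine lintegral_congr fun x => ?_
  rw [← mul_pow, ← enorm_mul]
  rfl

theorem normSq_add_le {X : FockSeq} (hX : ∀ n, AEStronglyMeasurable (X n) (photonMeasure n))
    (Z : FockSeq) : normSq (X + Z) ≤ 2 * normSq X + 2 * normSq Z := by
  simp_rw [normSq, ← ENNReal.tsum_mul_left, ← ENNReal.tsum_add]
  refine ENNReal.tsum_le_tsum fun n => ?_
  rw [← lintegral_const_mul' _ _ (by finiteness), ← lintegral_const_mul' _ _ (by finiteness),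
    ← lintegral_add_left' (((hX n).enorm.pow_const 2).const_mul 2)]
  refine lintegral_mono fun x => ?_
  calc ‖X n x + Z n x‖ₑ ^ 2 ≤ (‖X n x‖ₑ + ‖Z n x‖ₑ) ^ 2 := by
        gcongr
        exact enorm_add_le _ _
    _ ≤ 2 * (‖X n x‖ₑ ^ 2 + ‖Z n x‖ₑ ^ 2) := by
        have h := ENNReal.rpow_add_le_mul_rpow_add_rpow ‖X n x‖ₑ ‖Z n x‖ₑ (p := 2) one_le_two
        norm_num at h
        exact h
    _ = 2 * ‖X n x‖ₑ ^ 2 + 2 * ‖Z n x‖ₑ ^ 2 := mul_add _ _ _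

theorem IsFockVector.aestronglyMeasurable_annihilate (hΨ : IsFockVector Ψ)
    {g : Fin 2 → R3 → ℂ} (hg : ∀ l, MemLp (g l) 2) (n : ℕ) :
    AEStronglyMeasurable (annihilate g Ψ n) (photonMeasure n) :=
  .const_mul ((memLp_contract (memLp_onModes hg) (hΨ.memLp (n + 1))).1.congr
    (hΨ.pairing_lastPhoton_ae_eq hg n).symm) _

theorem normSq_quadrature_le (hΨ : IsFockVector Ψ) {g : Fin 2 → R3 → ℂ}
    (hg : ∀ l, MemLp (g l) 2) (hc : ‖c‖ₑ = 1) :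
    normSq (quadrature g c Ψ) ≤
      4 * normSq (annihilate g Ψ) + 2 * ((∑ l, ∫⁻ k, ‖g l k‖ₑ ^ 2) * normSq Ψ) := by
  refine (normSq_add_le (hΨ.aestronglyMeasurable_annihilate hg) _).trans_eq ?_
  rw [normSq_smul, hc, one_pow, one_mul,
    hΨ.normSq_create (G := fun l k => conj (g l k)) fun l => memLp_conj (hg l)]
  simp only [Complex.conj_conj, RCLike.enorm_conj]
  ring

theorem IsEnergyBounded.lintegral_tsum_normSq_quadrature_le {Y J : Type*} [MeasurableSpace Y]
    {ρ : Measure Y} [SFinite ρ] [Countable J] {g : J → Y → Fin 2 → R3 → ℂ}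
    (hbound : IsEnergyBounded ρ g) (hg : ∀ j, IsSmearingFamily ρ (g j)) (hΨ : IsFockVector Ψ)
    {c : J → ℂ} (hc : ∀ j, ‖c j‖ₑ = 1) :
    (1 / 4) * ∫⁻ y, ∑' j, normSq (quadrature (g j y) (c j) Ψ) ∂ρ ≤
      fieldEnergy Ψ +
        (1 / 2) * (∫⁻ y, (∑' j, ∑ l, ∫⁻ k, ‖g j y l k‖ₑ ^ 2) ∂ρ) * normSq Ψ := by
  have hquarter_four : (1 / 4 : ℝ≥0∞) * 4 = 1 := ENNReal.div_mul_cancel (by simp) (by simp)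
  have hquarter_two : (1 / 4 : ℝ≥0∞) * 2 = 1 / 2 := by
    rw [← ENNReal.toReal_eq_toReal_iff' (by simp [ENNReal.mul_eq_top]) (by simp)]
    norm_num
  have hmeas (j : J) := (hg j).aemeasurable_normSq_annihilate hΨ
  calc (1 / 4) * ∫⁻ y, ∑' j, normSq (quadrature (g j y) (c j) Ψ) ∂ρ
      ≤ (1 / 4) * ∫⁻ y, ∑' j, (4 * normSq (annihilate (g j y) Ψ) +
          2 * ((∑ l, ∫⁻ k, ‖g j y l k‖ₑ ^ 2) * normSq Ψ)) ∂ρ := by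
        gcongr with y j
        exact normSq_quadrature_le hΨ (fun l => (hg j).memLp y l) (hc j)
    _ = ∑' j, ∫⁻ y, normSq (annihilate (g j y) Ψ) ∂ρ +
          (1 / 2) * (∫⁻ y, (∑' j, ∑ l, ∫⁻ k, ‖g j y l k‖ₑ ^ 2) ∂ρ) * normSq Ψ := by
        simp_rw [ENNReal.tsum_add, ENNReal.tsum_mul_left, ENNReal.tsum_mul_right]
        rw [lintegral_add_left' ((AEMeasurable.tsum hmeas).const_mul 4),
          lintegral_const_mul' _ _ (by finiteness), lintegral_const_mul' _ _ (by finiteness),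
          lintegral_mul_const' _ _ hΨ.normSq_lt_top.ne, lintegral_tsum hmeas, mul_add,
          ← mul_assoc, hquarter_four, one_mul, ← mul_assoc (1 / 4), hquarter_two, mul_assoc (1 / 2)]
    _ ≤ _ := by
        gcongr
        exact hbound.tsum_lintegral_normSq_annihilate_le hg hΨ

end Quadratures

section AbsoluteConvergence

variable {α J : Type*} [MeasurableSpace α] {μ : Measure α} {w : α → ℝ}

theorem enorm_mul_toReal_le (a : ℝ) (b : ℝ≥0∞) : ‖a * b.toReal‖ₑ ≤ ‖a‖ₑ * b := by
  rw [enorm_mul, Real.enorm_of_nonneg ENNReal.toReal_nonneg]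
  gcongr
  exact ENNReal.ofReal_toReal_le

theorem integrable_mul_toReal (hw : AEStronglyMeasurable w μ) {N : α → ℝ≥0∞}
    (hN : AEMeasurable N μ) (h : ∫⁻ y, ‖w y‖ₑ * N y ∂μ < ∞) :
    Integrable (fun y => w y * (N y).toReal) μ :=
  ⟨hw.mul hN.ennreal_toReal.aestronglyMeasurable,
    (lintegral_mono fun _ => enorm_mul_toReal_le _ _).trans_lt h⟩

theorem ae_lt_top_of_lintegral_enorm_mul (hw : AEStronglyMeasurable w μ) {N : α → ℝ≥0∞}
    (hN : AEMeasurable N μ) (h : ∫⁻ y, ‖w y‖ₑ * N y ∂μ < ∞) :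
    ∀ᵐ y ∂μ, w y ≠ 0 → N y < ∞ := by
  filter_upwards [ae_lt_top' (hw.enorm.mul hN) h.ne] with y hy hwy
  exact ENNReal.lt_top_of_mul_ne_top_right hy.ne (by simpa using hwy)

theorem norm_integral_mul_toReal_le {N : α → ℝ≥0∞} (h : ∫⁻ y, ‖w y‖ₑ * N y ∂μ < ∞) :
    ‖∫ y, w y * (N y).toReal ∂μ‖ ≤ (∫⁻ y, ‖w y‖ₑ * N y ∂μ).toReal := by
  rw [← toReal_enorm]
  exact ENNReal.toReal_mono h.ne ((enorm_integral_le_lintegral_enorm _).trans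
    (lintegral_mono fun _ => enorm_mul_toReal_le _ _))

theorem summable_and_tsum_integral_mul_toReal_le {N : J → α → ℝ≥0∞} {E : ℝ≥0∞} (hE : E < ∞)
    (h : ∑' j, ∫⁻ y, ‖w y‖ₑ * N j y ∂μ ≤ E) :
    (Summable fun j => ∫ y, w y * (N j y).toReal ∂μ) ∧
      ∑' j, ∫ y, w y * (N j y).toReal ∂μ ≤ E.toReal := by
  have hsum := (h.trans_lt hE).ne
  have hfin (j : J) : ∫⁻ y, ‖w y‖ₑ * N j y ∂μ < ∞ :=
    (ENNReal.ne_top_of_tsum_ne_top hsum j).lt_top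
  have hmajorant := ENNReal.summable_toReal hsum
  have hsummable := Summable.of_norm_bounded hmajorant fun j => norm_integral_mul_toReal_le (hfin j)
  refine ⟨hsummable, ?_⟩
  calc ∑' j, ∫ y, w y * (N j y).toReal ∂μ ≤ ∑' j, (∫⁻ y, ‖w y‖ₑ * N j y ∂μ).toReal :=
        hsummable.tsum_le_tsum
          (fun j => (le_abs_self _).trans (norm_integral_mul_toReal_le (hfin j))) hmajorant
    _ = (∑' j, ∫⁻ y, ‖w y‖ₑ * N j y ∂μ).toReal :=
        (ENNReal.tsum_toReal_eq fun j => (hfin j).ne).symm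
    _ ≤ E.toReal := ENNReal.toReal_mono hE.ne h

end AbsoluteConvergence

section PlaneWaveBound

variable {V ι J : Type*} [NormedAddCommGroup V] [InnerProductSpace ℝ V] [FiniteDimensional ℝ V]
  [MeasurableSpace V] [BorelSpace V] [Fintype ι] {G : ι → V → ℂ} {ψ : ι → V → ℂ}

theorem pairing_mul_planeWave (hG : ∀ l, MemLp (G l) 2) (hψ : ∀ l, MemLp (ψ l) 2) (y : V) :
    pairing (fun l k => G l k * planeWave y k) ψ = ∫ k, (∑ l, G l k * ψ l k) * planeWave y k := by
  have hwave := (isSmearingFamily_mul_planeWave (ρ := 0) hG).memLp y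
  refine (integral_finsetSum _ fun l _ => (hwave l).integrable_mul (hψ l)).symm.trans
    (integral_congr_ae (Eventually.of_forall fun k => ?_))
  simp only [Finset.sum_mul, Pi.mul_apply, mul_right_comm]

theorem isEnergyBounded_mul_planeWave [Fintype J] {G : J → ι → V → ℂ}
    (hG : ∀ j l, MemLp (G j l) 2)
    (hle : ∀ (c : ι → ℂ) (k : V),
      ∑ j, ‖∑ l, G j l k * c l‖ₑ ^ 2 ≤ ENNReal.ofReal ‖k‖ * ∑ l, ‖c l‖ₑ ^ 2) :
    IsEnergyBounded
      (ENNReal.ofReal ((2 * Real.pi) ^ Module.finrank ℝ V)⁻¹ • (volume : Measure V))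
      fun j y l k => G j l k * planeWave y k := by
  intro ψ hψ
  rcases eq_or_ne (photonEnergy ψ) ∞ with htop | hfin
  · exact htop ▸ le_top
  let φ (j : J) (k : V) : ℂ := ∑ l, G j l k * ψ l k
  have hint (j : J) : Integrable (φ j) :=
    integrable_finsetSum _ fun l _ => (hG j l).integrable_mul (hψ l)
  have hsum : ∑ j, ∫⁻ k, ‖φ j k‖ₑ ^ 2 ≤ photonEnergy ψ := by
    rw [← lintegral_finsetSum' _ fun j _ => (hint j).1.enorm.pow_const 2, photonEnergy,
      ← lintegral_finsetSum' _ fun l _ =>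
        (by fun_prop : AEMeasurable fun k : V => ENNReal.ofReal ‖k‖).mul
          ((hψ l).1.enorm.pow_const 2)]
    refine lintegral_mono fun k => ?_
    simpa only [Finset.mul_sum] using hle (fun l => ψ l k) k
  have hφ (j : J) : MemLp (φ j) 2 := memLp_two_iff_lintegral.2 ⟨(hint j).1,
    ENNReal.sum_lt_top.1 (hsum.trans_lt hfin.lt_top) j (Finset.mem_univ j)⟩
  have hpi : (0 : ℝ) < (2 * Real.pi) ^ Module.finrank ℝ V := by positivity
  rw [tsum_fintype]
  refine (Finset.sum_congr rfl fun j _ => ?_).trans_le hsum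
  simp_rw [pairing_mul_planeWave (hG j) hψ]
  rw [lintegral_smul_measure, lintegral_planeWave_sq (hint j) (hφ j), smul_eq_mul, ← mul_assoc,
    ← ENNReal.ofReal_mul (by positivity), inv_mul_cancel₀ hpi.ne', ENNReal.ofReal_one, one_mul]

end PlaneWaveBound

section MagneticModes

variable {Λ : ℝ} {ε : Fin 2 → R3 → R3}

theorem integral_Ioi_sq_mul_indicator (hΛ : 0 ≤ Λ) :
    ∫ r in Set.Ioi (0 : ℝ), r ^ 2 * (Set.Iic Λ).indicator id r = Λ ^ 4 / 4 := by
  have hcube : (fun r : ℝ => r ^ 2 * (Set.Iic Λ).indicator id r) =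
      (Set.Iic Λ).indicator fun r => r ^ 3 := by
    funext r
    by_cases hr : r ∈ Set.Iic Λ
    · simp only [hr, Set.indicator_of_mem, id_eq]
      ring
    · simp [hr]
  rw [hcube, setIntegral_indicator measurableSet_Iic, Set.Ioi_inter_Iic,
    ← intervalIntegral.integral_of_le hΛ, integral_pow]
  norm_num

theorem lintegral_closedBall_norm (hΛ : 0 ≤ Λ) :
    ∫⁻ k in Metric.closedBall (0 : R3) Λ, ENNReal.ofReal ‖k‖ =
      ENNReal.ofReal (Real.pi * Λ ^ 4) := by
  have hint : IntegrableOn (fun k : R3 => ‖k‖) (Metric.closedBall 0 Λ) :=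
    continuous_norm.continuousOn.integrableOn_compact (isCompact_closedBall 0 Λ)
  have hradial : (Metric.closedBall (0 : R3) Λ).indicator (fun k => ‖k‖) =
      fun k => (Set.Iic Λ).indicator id ‖k‖ := by
    funext k
    by_cases hk : ‖k‖ ≤ Λ <;> simp [hk]
  rw [← ofReal_integral_eq_lintegral_ofReal hint (Eventually.of_forall fun k => norm_nonneg k),
    ← integral_indicator measurableSet_closedBall, hradial,
    integral_fun_norm_addHaar volume ((Set.Iic Λ).indicator id), Measure.real,
    EuclideanSpace.volume_ball_fin_three, ENNReal.ofReal_one, one_pow, one_mul,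
    ENNReal.toReal_ofReal (by positivity), finrank_euclideanSpace, Fintype.card_fin]
  simp only [smul_eq_mul, nsmul_eq_mul, integral_Ioi_sq_mul_indicator hΛ]
  congr 1
  push_cast
  ring

theorem lintegral_closedBall_norm_le (Λ : ℝ) :
    ∫⁻ k in Metric.closedBall (0 : R3) Λ, ENNReal.ofReal ‖k‖ ≤
      ENNReal.ofReal (Real.pi * Λ ^ 4) := by
  rcases lt_or_ge Λ 0 with hΛ | hΛ
  · simp [Metric.closedBall_eq_empty.2 hΛ]
  · exact (lintegral_closedBall_norm hΛ).le

theorem sum_norm_sq_of_orthogonal {u v : Fin 3 → ℝ} {r : ℝ} (hu : u ⬝ᵥ u = r) (hv : v ⬝ᵥ v = r)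
    (huv : u ⬝ᵥ v = 0) (a b : ℂ) :
    ∑ j, ‖(u j : ℂ) * a + (v j : ℂ) * b‖ ^ 2 = r * (‖a‖ ^ 2 + ‖b‖ ^ 2) := by
  simp only [dotProduct, Fin.sum_univ_three] at hu hv huv
  simp only [Fin.sum_univ_three, Complex.sq_norm, Complex.normSq_apply, Complex.add_re,
    Complex.add_im, Complex.re_ofReal_mul, Complex.im_ofReal_mul]
  linear_combination (a.re ^ 2 + a.im ^ 2) * hu + (b.re ^ 2 + b.im ^ 2) * hv +
    2 * (a.re * b.re + a.im * b.im) * huv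

theorem dotProduct_crossProduct_polarization (hε : IsPolarization ε) {k : R3} (hk : k ≠ 0)
    (l m : Fin 2) :
    crossProduct k.ofLp (ε l k).ofLp ⬝ᵥ crossProduct k.ofLp (ε m k).ofLp =
      ‖k‖ ^ 2 * (if l = m then 1 else 0) := by
  have hinner (a b : R3) : a.ofLp ⬝ᵥ b.ofLp = inner ℝ a b := by
    simp [PiLp.inner_apply, dotProduct, mul_comm]
  rw [cross_dot_cross, hinner, hinner, hinner, hinner, hε.perp m k hk,
    real_inner_self_eq_norm_sq, orthonormal_iff_ite.1 (hε.orthonormal k hk) l m]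
  ring

theorem magneticMode_neg (Λ : ℝ) (ε : Fin 2 → R3 → R3) (j : Fin 3) (x : R3) :
    magneticMode Λ ε j (-x) = fun l k => conj (magneticMode Λ ε j x l k) := by
  funext l k
  by_cases hk : k ∈ Metric.closedBall (0 : R3) Λ
  · simp only [magneticMode, hk, Set.indicator_of_mem, map_mul, Complex.conj_ofReal,
      ← Complex.exp_conj, Complex.conj_I, inner_neg_right, Complex.ofReal_neg, mul_neg, neg_mul]
  · simp only [magneticMode, hk, not_false_eq_true, Set.indicator_of_notMem, map_zero]

theorem sum_enorm_sq_magneticMode (hε : IsPolarization ε) (x : R3) (c : Fin 2 → ℂ) (k : R3) :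
    ∑ j, ‖∑ l, magneticMode Λ ε j x l k * c l‖ₑ ^ 2 =
      (Metric.closedBall (0 : R3) Λ).indicator
        (fun k => ENNReal.ofReal ‖k‖ * ∑ l, ‖c l‖ₑ ^ 2) k := by
  by_cases hkΛ : k ∈ Metric.closedBall (0 : R3) Λ
  swap
  · simp [magneticMode, hkΛ]
  rcases eq_or_ne k 0 with rfl | hk
  · simp only [magneticMode, Set.indicator_of_mem hkΛ]
    simp
  have hknorm : 0 < ‖k‖ := norm_pos_iff.2 hk
  let u (l : Fin 2) : Fin 3 → ℝ := (Real.sqrt ‖k‖)⁻¹ • crossProduct k.ofLp (ε l k).ofLp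
  have hu (l m : Fin 2) : u l ⬝ᵥ u m = ‖k‖ * (if l = m then 1 else 0) := by
    rw [smul_dotProduct, dotProduct_smul, dotProduct_crossProduct_polarization hε hk,
      smul_smul, ← mul_inv, Real.mul_self_sqrt hknorm.le, smul_eq_mul]
    field_simp
  have hmode (j : Fin 3) (l : Fin 2) :
      magneticMode Λ ε j x l k * c l = (u l j : ℂ) * (planeWave x k * c l) := by
    simp only [magneticMode, Set.indicator_of_mem hkΛ, mul_assoc, planeWave, u, Pi.smul_apply,
      smul_eq_mul, div_eq_inv_mul]
  have hnorm (l : Fin 2) : ‖planeWave x k * c l‖ₑ = ‖c l‖ₑ := by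
    rw [enorm_mul, enorm_planeWave, one_mul]
  have horth := sum_norm_sq_of_orthogonal (by simpa using hu 0 0) (by simpa using hu 1 1)
    (by simpa using hu 0 1) (planeWave x k * c 0) (planeWave x k * c 1)
  simp_rw [Set.indicator_of_mem hkΛ, hmode, ← hnorm, ← ofReal_norm,
    ← ENNReal.ofReal_pow (norm_nonneg _), Fin.sum_univ_two]
  rw [← ENNReal.ofReal_add (by positivity) (by positivity), ← ENNReal.ofReal_mul hknorm.le,
    ← horth, ENNReal.ofReal_sum_of_nonneg fun j _ => by positivity]

theorem sum_enorm_sq_magneticMode_polarization (hε : IsPolarization ε) (x : R3) (l : Fin 2)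
    (k : R3) : ∑ j, ‖magneticMode Λ ε j x l k‖ₑ ^ 2 =
      (Metric.closedBall (0 : R3) Λ).indicator (fun k => ENNReal.ofReal ‖k‖) k := by
  have hsum : ∑ m, ‖(Pi.single l 1 : Fin 2 → ℂ) m‖ₑ ^ 2 = 1 := by
    rw [Finset.sum_eq_single l (fun m _ hm => by simp [hm]) (by simp)]
    simp
  have hsingle := sum_enorm_sq_magneticMode (Λ := Λ) hε x (Pi.single l 1) k
  simp_rw [hsum, mul_one] at hsingle
  simpa [Pi.single_apply] using hsingle

theorem measurable_magneticMode (hε : IsPolarization ε) (j : Fin 3) (x : R3) (l : Fin 2) :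
    Measurable (magneticMode Λ ε j x l) := by
  have hmomentum (i : Fin 3) : Measurable fun k : R3 => k.ofLp i :=
    (EuclideanSpace.proj (𝕜 := ℝ) i).continuous.measurable
  have hpolarization (i : Fin 3) : Measurable fun k => (ε l k).ofLp i :=
    (hmomentum i).comp (hε.measurable l)
  have hcross : Measurable fun k : R3 => crossProduct k.ofLp (ε l k).ofLp j := by
    simp only [cross_apply]
    fin_cases j
    · exact ((hmomentum 1).mul (hpolarization 2)).sub ((hmomentum 2).mul (hpolarization 1))
    · exact ((hmomentum 2).mul (hpolarization 0)).sub ((hmomentum 0).mul (hpolarization 2))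
    · exact ((hmomentum 0).mul (hpolarization 1)).sub ((hmomentum 1).mul (hpolarization 0))
  exact Measurable.indicator (by fun_prop) measurableSet_closedBall

theorem sum_lintegral_magneticMode_le (hε : IsPolarization ε) (x : R3) :
    ∑ j, ∑ l, ∫⁻ k, ‖magneticMode Λ ε j x l k‖ₑ ^ 2 ≤ 2 * ENNReal.ofReal (Real.pi * Λ ^ 4) := by
  have hpolarization (l : Fin 2) :
      ∑ j, ∫⁻ k, ‖magneticMode Λ ε j x l k‖ₑ ^ 2 ≤ ENNReal.ofReal (Real.pi * Λ ^ 4) := by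
    rw [← lintegral_finsetSum _ fun j _ => (measurable_magneticMode hε j x l).enorm.pow_const 2]
    simp_rw [sum_enorm_sq_magneticMode_polarization hε]
    rw [lintegral_indicator measurableSet_closedBall]
    exact lintegral_closedBall_norm_le Λ
  rw [Finset.sum_comm, Fin.sum_univ_two, two_mul]
  exact add_le_add (hpolarization 0) (hpolarization 1)

theorem memLp_magneticMode (hε : IsPolarization ε) (j : Fin 3) (x : R3) (l : Fin 2) :
    MemLp (magneticMode Λ ε j x l) 2 := by
  refine memLp_two_iff_lintegral.2 ⟨(measurable_magneticMode hε j x l).aestronglyMeasurable, ?_⟩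
  have hfin := (sum_lintegral_magneticMode_le (Λ := Λ) hε x).trans_lt
    (ENNReal.mul_lt_top (by simp) ENNReal.ofReal_lt_top)
  exact ENNReal.sum_lt_top.1 (ENNReal.sum_lt_top.1 hfin j (Finset.mem_univ j)) l
    (Finset.mem_univ l)

theorem magneticMode_eq_mul_planeWave (Λ : ℝ) (ε : Fin 2 → R3 → R3) :
    magneticMode Λ ε = fun j x l k => magneticMode Λ ε j 0 l k * planeWave x k := by
  funext j x l k
  by_cases hk : k ∈ Metric.closedBall (0 : R3) Λ
  · simp only [magneticMode, planeWave, hk, Set.indicator_of_mem, inner_zero_right,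
      Complex.ofReal_zero, mul_zero, Complex.exp_zero, mul_one]
  · simp only [magneticMode, hk, not_false_eq_true, Set.indicator_of_notMem, zero_mul]

theorem isSmearingFamily_magneticMode {ρ : Measure R3} (hε : IsPolarization ε)
    (j : Fin 3) : IsSmearingFamily ρ (magneticMode Λ ε j) := by
  rw [magneticMode_eq_mul_planeWave]
  exact isSmearingFamily_mul_planeWave (memLp_magneticMode hε j 0)

theorem isEnergyBounded_magneticMode (hε : IsPolarization ε) :
    IsEnergyBounded (ENNReal.ofReal ((2 * Real.pi) ^ 3)⁻¹ • volume) (magneticMode Λ ε) := by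
  rw [magneticMode_eq_mul_planeWave]
  simpa only [finrank_euclideanSpace, Fintype.card_fin] using
    isEnergyBounded_mul_planeWave (fun j => memLp_magneticMode hε j 0) fun c k =>
      (sum_enorm_sq_magneticMode hε 0 c k).trans_le (Set.indicator_le_self _ _ _)

theorem normSq_magneticField (Λ : ℝ) (ε : Fin 2 → R3 → R3) (j : Fin 3) (x : R3) (Ψ : FockSeq) :
    normSq (magneticField Λ ε j x Ψ) =
      ENNReal.ofReal (1 / (4 * Real.pi ^ 2)) *
        normSq (quadrature (magneticMode Λ ε j x) (-1) Ψ) := by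
  have hconst : ‖(Complex.I / (2 * Real.pi) : ℂ)‖ₑ ^ 2 =
      ENNReal.ofReal (1 / (4 * Real.pi ^ 2)) := by
    rw [← ofReal_norm, ← ENNReal.ofReal_pow (norm_nonneg _)]
    congr 1
    simp only [norm_div, Complex.norm_I, norm_mul, Complex.norm_real, Real.norm_eq_abs,
      abs_of_pos Real.pi_pos, Complex.norm_ofNat]
    ring
  rw [magneticField, normSq_smul, hconst, magneticMode_neg, quadrature, neg_one_smul,
    sub_eq_add_neg]

end MagneticModes

section FieldEnergyBounds

variable {Λ : ℝ} {w : R3 → ℝ} {Ψ : FockSeq}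

section SmearedModes

variable {J : Set ℤ} {v : Fin 2 → J → 𝓢'(R3, ℂ)} {vhat : Fin 2 → J → R3 → ℂ}

theorem tsum_lintegral_enorm_mul_normSq_fieldL_le
    (hv : ∀ l j, IsFourierTransformOf (vhat l j) (v l j))
    (hG : ∀ j l, MemLp (modeFunction Λ (fun l => vhat l j) 0 l) 2)
    (hw : AEStronglyMeasurable w volume) (h : weightNorm v w ≤ 1) (hΨ : IsFockVector Ψ) :
    ∑' j, ∫⁻ y, ‖w y‖ₑ * normSq (fieldL Λ (fun l => vhat l j) y Ψ) ≤ fieldEnergy Ψ := by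
  simp_rw [← lintegral_withDensity_enorm hw]
  exact (isEnergyBounded_modeFunction hv hG hw h).tsum_lintegral_normSq_annihilate_le
    (fun j => isSmearingFamily_modeFunction (hG j)) hΨ

theorem tsum_lintegral_normSq_fieldL_add_fieldLstar_le
    (hv : ∀ l j, IsFourierTransformOf (vhat l j) (v l j))
    (hG : ∀ j l, MemLp (modeFunction Λ (fun l => vhat l j) 0 l) 2)
    (hw : AEStronglyMeasurable w volume) (h : weightNorm v w ≤ 1) (hΨ : IsFockVector Ψ)
    {c : J → ℂ} (hc : ∀ j, ‖c j‖ₑ = 1) :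
    (1 / 4) * ∑' j, ∫⁻ y, ‖w y‖ₑ * normSq (fieldL Λ (fun l => vhat l j) y Ψ +
        c j • fieldLstar Λ (fun l => vhat l j) y Ψ) ≤
      fieldEnergy Ψ + (1 / 2) * (∑' j, ∑ l, ∫⁻ k in Metric.ball (0 : R3) Λ,
        ENNReal.ofReal ‖k‖ * ‖vhat l j k‖ₑ ^ 2) * (∫⁻ y, ‖w y‖ₑ) * normSq Ψ := by
  have hbound := (isEnergyBounded_modeFunction hv hG hw h).lintegral_tsum_normSq_quadrature_le
    (fun j => isSmearingFamily_modeFunction (hG j)) hΨ hc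
  simp_rw [lintegral_modeFunction_sq, lintegral_const,
    withDensity_apply _ MeasurableSet.univ, setLIntegral_univ, ← mul_assoc] at hbound
  refine le_trans ?_ hbound
  simp_rw [← lintegral_withDensity_enorm hw]
  gcongr
  exact tsum_lintegral_le_lintegral_tsum _

theorem integrable_and_summable_and_tsum_le_normSq_fieldL
    (hv : ∀ l j, IsFourierTransformOf (vhat l j) (v l j))
    (hG : ∀ j l, MemLp (modeFunction Λ (fun l => vhat l j) 0 l) 2)
    (hw : AEStronglyMeasurable w volume) (h : weightNorm v w ≤ 1) (hΨ : IsFockVector Ψ)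
    (hE : fieldEnergy Ψ < ∞) :
    (∀ j, ∀ᵐ y, w y ≠ 0 → normSq (fieldL Λ (fun l => vhat l j) y Ψ) < ∞) ∧
      (∀ j, Integrable fun y => w y * (normSq (fieldL Λ (fun l => vhat l j) y Ψ)).toReal) ∧
      (Summable fun j => ∫ y, w y * (normSq (fieldL Λ (fun l => vhat l j) y Ψ)).toReal) ∧
      ∑' j, ∫ y, w y * (normSq (fieldL Λ (fun l => vhat l j) y Ψ)).toReal ≤
        (fieldEnergy Ψ).toReal := by
  have hle := tsum_lintegral_enorm_mul_normSq_fieldL_le hv hG hw h hΨ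
  have hN (j : J) : AEMeasurable fun y => normSq (fieldL Λ (fun l => vhat l j) y Ψ) :=
    (isSmearingFamily_modeFunction (hG j)).aemeasurable_normSq_annihilate hΨ
  have hlt (j : J) : ∫⁻ y, ‖w y‖ₑ * normSq (fieldL Λ (fun l => vhat l j) y Ψ) < ∞ :=
    ((ENNReal.le_tsum j).trans hle).trans_lt hE
  exact ⟨fun j => ae_lt_top_of_lintegral_enorm_mul hw (hN j) (hlt j),
    fun j => integrable_mul_toReal hw (hN j) (hlt j),
    summable_and_tsum_integral_mul_toReal_le hE hle⟩

end SmearedModes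

theorem lintegral_normSq_quadrature_magneticMode_le {ε : Fin 2 → R3 → R3} (hε : IsPolarization ε)
    (hw : AEStronglyMeasurable w volume) (hw1 : ∀ y, ‖w y‖ₑ ≤ 1) (hΨ : IsFockVector Ψ) {c : ℂ}
    (hc : ‖c‖ₑ = 1) :
    (1 / 4) * (ENNReal.ofReal ((2 * Real.pi) ^ 3)⁻¹ *
        ∫⁻ x, ‖w x‖ₑ * ∑ j, normSq (quadrature (magneticMode Λ ε j x) c Ψ)) ≤
      fieldEnergy Ψ + (1 / 2) * (ENNReal.ofReal ((2 * Real.pi) ^ 3)⁻¹ *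
        ∫⁻ x, ‖w x‖ₑ * (2 * ENNReal.ofReal (Real.pi * Λ ^ 4))) * normSq Ψ := by
  let κ : ℝ≥0∞ := ENNReal.ofReal ((2 * Real.pi) ^ 3)⁻¹
  let ρ : Measure R3 := κ • volume.withDensity fun y => ‖w y‖ₑ
  have hρ (F : R3 → ℝ≥0∞) : ∫⁻ y, F y ∂ρ = κ * ∫⁻ y, ‖w y‖ₑ * F y := by
    rw [lintegral_smul_measure, lintegral_withDensity_enorm hw, smul_eq_mul]
  have hle : ρ ≤ κ • volume := by
    dsimp only [ρ]
    gcongr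
    exact withDensity_enorm_le hw1
  have hbound := ((isEnergyBounded_magneticMode (Λ := Λ) hε).mono
    hle).lintegral_tsum_normSq_quadrature_le (isSmearingFamily_magneticMode hε) hΨ fun _ => hc
  simp_rw [tsum_fintype, hρ] at hbound
  refine hbound.trans ?_
  gcongr with x
  exact sum_lintegral_magneticMode_le hε x

theorem lintegral_normSq_magneticField_le {ε : Fin 2 → R3 → R3} (hε : IsPolarization ε)
    (hw : AEStronglyMeasurable w volume) (hw1 : ∀ y, ‖w y‖ₑ ≤ 1) (hΨ : IsFockVector Ψ) :
    ENNReal.ofReal (1 / (8 * Real.pi)) *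
        ∫⁻ x, ‖w x‖ₑ * ∑ j, normSq (magneticField Λ ε j x Ψ) ≤
      fieldEnergy Ψ + ENNReal.ofReal (Λ ^ 4 / (8 * Real.pi ^ 2)) * (∫⁻ y, ‖w y‖ₑ) * normSq Ψ := by
  have hquarter : (1 / 4 : ℝ≥0∞) = ENNReal.ofReal (1 / 4) := by
    rw [ENNReal.ofReal_div_of_pos (by norm_num)]
    simp
  have hfield : ENNReal.ofReal (1 / (8 * Real.pi)) * ENNReal.ofReal (1 / (4 * Real.pi ^ 2)) =
      1 / 4 * ENNReal.ofReal ((2 * Real.pi) ^ 3)⁻¹ := by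
    rw [hquarter, ← ENNReal.ofReal_mul (by positivity), ← ENNReal.ofReal_mul (by positivity)]
    congr 1
    field_simp
    norm_num
  have hvacuum : 1 / 2 * (ENNReal.ofReal ((2 * Real.pi) ^ 3)⁻¹ *
      (2 * ENNReal.ofReal (Real.pi * Λ ^ 4))) = ENNReal.ofReal (Λ ^ 4 / (8 * Real.pi ^ 2)) := by
    rw [mul_left_comm, ← mul_assoc (1 / 2), ENNReal.div_mul_cancel (by simp) (by simp), one_mul,
      ← ENNReal.ofReal_mul (by positivity)]
    congr 1
    field_simp
    ring
  have hbound := lintegral_normSq_quadrature_magneticMode_le (Λ := Λ) (c := -1) hε hw hw1 hΨ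
    (by simp)
  rw [← mul_assoc, ← hfield, lintegral_mul_const' _ _ (by finiteness),
    mul_left_comm _ (∫⁻ y, ‖w y‖ₑ), mul_left_comm _ (∫⁻ y, ‖w y‖ₑ), hvacuum,
    mul_comm (∫⁻ y, ‖w y‖ₑ)] at hbound
  refine hbound.trans' (le_of_eq ?_)
  simp_rw [normSq_magneticField, ← Finset.mul_sum, mul_left_comm ‖w _‖ₑ]
  rw [lintegral_const_mul' _ _ (by finiteness), ← mul_assoc]

end FieldEnergyBounds

theorem mainTheorem6_general (Λ : ℝ) :
    (∀ (J : Set ℤ) (v : Fin 2 → J → 𝓢'(R3, ℂ)) (vhat : Fin 2 → J → R3 → ℂ) (w : R3 → ℝ),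
      (∀ l j, IsFourierTransformOf (vhat l j) (v l j)) →
      (∀ l j, ∫⁻ k in Metric.ball (0 : R3) Λ, ENNReal.ofReal ‖k‖ * ‖vhat l j k‖ₑ ^ 2 < ∞) →
      AEStronglyMeasurable w volume →
      weightNorm v w ≤ 1 →
      (∀ Ψ : FockSeq, IsFockVector Ψ → fieldEnergy Ψ < ∞ →
        (∀ j, ∀ᵐ y, w y ≠ 0 → normSq (fieldL Λ (fun l => vhat l j) y Ψ) < ∞) ∧
        (∀ j, Integrable fun y => w y * (normSq (fieldL Λ (fun l => vhat l j) y Ψ)).toReal) ∧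
        (Summable fun j => ∫ y, w y * (normSq (fieldL Λ (fun l => vhat l j) y Ψ)).toReal) ∧
        ∑' j, ∫ y, w y * (normSq (fieldL Λ (fun l => vhat l j) y Ψ)).toReal ≤
          (fieldEnergy Ψ).toReal) ∧
      ((∀ y, 0 ≤ w y) → ∀ (s : J → ℤˣ) (Ψ : FockSeq), IsFockVector Ψ →
        (1 / 4) * ∑' j, ∫⁻ y, ENNReal.ofReal (w y) *
            normSq (fieldL Λ (fun l => vhat l j) y Ψ +
              ((s j : ℤ) : ℂ) • fieldLstar Λ (fun l => vhat l j) y Ψ)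
          ≤ fieldEnergy Ψ +
            (1 / 2) * (∑' j, ∑ l, ∫⁻ k in Metric.ball (0 : R3) Λ,
                ENNReal.ofReal ‖k‖ * ‖vhat l j k‖ₑ ^ 2) *
              (∫⁻ y, ENNReal.ofReal (w y)) * normSq Ψ)) ∧
    (∀ (ε : Fin 2 → R3 → R3) (w : R3 → ℝ), IsPolarization ε → AEStronglyMeasurable w volume →
      (∀ y, 0 ≤ w y ∧ w y ≤ 1) →
      ∀ Ψ : FockSeq, IsFockVector Ψ →
        ENNReal.ofReal (1 / (8 * Real.pi)) *
            ∫⁻ x, ENNReal.ofReal (w x) * ∑ j, normSq (magneticField Λ ε j x Ψ)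
          ≤ fieldEnergy Ψ +
            ENNReal.ofReal (Λ ^ 4 / (8 * Real.pi ^ 2)) *
              (∫⁻ y, ENNReal.ofReal (w y)) * normSq Ψ) := by
  refine ⟨fun J v vhat w hv hfin hw h => ?_, fun ε w hε hw hw01 Ψ hΨ => ?_⟩
  · have hG (j : J) (l : Fin 2) : MemLp (modeFunction Λ (fun l => vhat l j) 0 l) 2 :=
      memLp_modeFunction (vhat := fun l => vhat l j)
        (hv l j).locallyIntegrable.aestronglyMeasurable (hfin l j) 0
    refine ⟨fun Ψ hΨ hE => integrable_and_summable_and_tsum_le_normSq_fieldL hv hG hw h hΨ hE,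
      fun hw0 s Ψ hΨ => ?_⟩
    have henorm (y : R3) : ENNReal.ofReal (w y) = ‖w y‖ₑ := (Real.enorm_of_nonneg (hw0 y)).symm
    simp only [henorm]
    exact tsum_lintegral_normSq_fieldL_add_fieldLstar_le hv hG hw h hΨ fun j => by
      rcases Int.units_eq_one_or (s j) with hs | hs <;> simp [hs]
  · have henorm (y : R3) : ENNReal.ofReal (w y) = ‖w y‖ₑ :=
      (Real.enorm_of_nonneg (hw01 y).1).symm
    simp only [henorm]
    exact lintegral_normSq_magneticField_le hε hw
      (fun y => henorm y ▸ ENNReal.ofReal_le_one.2 (hw01 y).2) hΨ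

end

end FieldEnergy

/-- Operator inequalities are inequalities of quadratic forms. For a symmetric operator `X` the form
of `X²` is `‖X Ψ‖²`, so the form of `L* L` is `‖L Ψ‖²`, and, as `L + s L*` is symmetric for `s = 1`
and antisymmetric for `s = -1`, the form of `s (L + s L*)²` is `‖(L + s L*) Ψ‖²` in both cases.
The subtracted constants are added to the other side, in `[0, ∞]`. -/
theorem mainTheorem6 (Λ : ℝ) (hΛ : 0 < Λ) :
    (∀ (J : Set ℤ) (v : Fin 2 → J → 𝓢'(FieldEnergy.R3, ℂ))
      (vhat : Fin 2 → J → FieldEnergy.R3 → ℂ) (w : FieldEnergy.R3 → ℝ),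
      (∀ l j, FieldEnergy.IsFourierTransformOf (vhat l j) (v l j)) →
      (∀ l j, ∫⁻ k in Metric.ball (0 : FieldEnergy.R3) Λ,
        ENNReal.ofReal ‖k‖ * ‖vhat l j k‖ₑ ^ 2 < ∞) →
      Integrable w →
      FieldEnergy.weightNorm v w ≤ 1 →
      -- `H_f ≥ ∑_j ∫ w L_j* L_j`
      (∀ Ψ : FieldEnergy.FockSeq, FieldEnergy.IsFockVector Ψ → FieldEnergy.fieldEnergy Ψ < ∞ →
        (∀ j, ∀ᵐ y, w y ≠ 0 →
          FieldEnergy.normSq (FieldEnergy.fieldL Λ (fun l => vhat l j) y Ψ) < ∞) ∧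
        (∀ j, Integrable fun y =>
          w y * (FieldEnergy.normSq (FieldEnergy.fieldL Λ (fun l => vhat l j) y Ψ)).toReal) ∧
        (Summable fun j => ∫ y,
          w y * (FieldEnergy.normSq (FieldEnergy.fieldL Λ (fun l => vhat l j) y Ψ)).toReal) ∧
        ∑' j, ∫ y,
            w y * (FieldEnergy.normSq (FieldEnergy.fieldL Λ (fun l => vhat l j) y Ψ)).toReal
          ≤ (FieldEnergy.fieldEnergy Ψ).toReal) ∧
      -- `H_f ≥ ¼ ∑_j ± ∫ w (L_j ± L_j*)² - ½ ∑_j ∑_λ ∫_{|k| < Λ} |k| |vhat_{λ,j}|² ∫ w`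
      ((∀ y, 0 ≤ w y) → ∀ (s : J → ℤˣ) (Ψ : FieldEnergy.FockSeq), FieldEnergy.IsFockVector Ψ →
        (1 / 4) * ∑' j, ∫⁻ y, ENNReal.ofReal (w y) *
            FieldEnergy.normSq (FieldEnergy.fieldL Λ (fun l => vhat l j) y Ψ +
              ((s j : ℤ) : ℂ) • FieldEnergy.fieldLstar Λ (fun l => vhat l j) y Ψ)
          ≤ FieldEnergy.fieldEnergy Ψ +
            (1 / 2) * (∑' j, ∑ l, ∫⁻ k in Metric.ball (0 : FieldEnergy.R3) Λ,
                ENNReal.ofReal ‖k‖ * ‖vhat l j k‖ₑ ^ 2) *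
              (∫⁻ y, ENNReal.ofReal (w y)) * FieldEnergy.normSq Ψ)) ∧
    -- `H_f ≥ (1/8π) ∫ B^Λ(x)² w(x) dx - (Λ⁴/8π²) ∫ w`
    (∀ (ε : Fin 2 → FieldEnergy.R3 → FieldEnergy.R3) (w : FieldEnergy.R3 → ℝ),
      FieldEnergy.IsPolarization ε →
      Integrable w →
      (∀ y, 0 ≤ w y ∧ w y ≤ 1) →
      ∀ Ψ : FieldEnergy.FockSeq, FieldEnergy.IsFockVector Ψ →
        ENNReal.ofReal (1 / (8 * Real.pi)) *
            ∫⁻ x, ENNReal.ofReal (w x) *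
              ∑ j, FieldEnergy.normSq (FieldEnergy.magneticField Λ ε j x Ψ)
          ≤ FieldEnergy.fieldEnergy Ψ +
            ENNReal.ofReal (Λ ^ 4 / (8 * Real.pi ^ 2)) *
              (∫⁻ y, ENNReal.ofReal (w y)) * FieldEnergy.normSq Ψ) := by
  have h := FieldEnergy.mainTheorem6_general Λ
  exact ⟨fun J v vhat w hv hfin hw => h.1 J v vhat w hv hfin hw.1,
    fun ε w hε hw => h.2 ε w hε hw.1⟩
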